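/- **Setting.** Let $G=(V,E)$ be a finite bipartite graph without multiple edges, with colour classes $W$ and $F$ and capacities $b:E\to\mathbb Z_{\ge 0}$. For $v\in V$ let $E_v$ be the set of edges at $v$, let $\mathcal B=\{x\in\mathbb Z^E: 0\le x\le b\}$, let $\mathcal B_v$ be its restriction to $E_v$, and write $x_v=x|_{E_v}$. Every $v\in V$ has a choice function $C_v:\mathcal B_v\to\mathcal B_v$ with $C_v(z)\le z$ such that for all $z\ge z'$ in $\mathcal B_v$: (A1) if $z'\ge C_v(z)$ then $C_v(z')=C_v(z)$; (A2) $C_v(z)\wedge z'\le C_v(z')$ (coordinatewise minimum); (A3) $\sum_e C_v(z)(e)\ge\sum_e C_v(z')(e)$. A vector $z\in\mathcal B_v$ is *acceptable* for $v$ if $C_v(z)=z$. For acceptable $z'\ne z$ write $z'\prec_v z$ if $C_v(z\vee z')=z$. A *g-matching* is an $x\in\mathcal B$ such that $x_v$ is acceptable for all $v\in V$. For distinct g-matchings, $x\prec_F y$ means that for every $f\in F$ either $x_f=y_f$ or $x_f\prec_f y_f$; and $x\preceq_F y$ means $x=y$ or $x\prec_F y$. An edge $e\in E_v$ is *interesting*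 for $v$ under $z$ if there is $z'\in\mathcal B_v$ with $z'(e)>z(e)$, $z'(e')=z(e')$ for $e'\neq e$, and $C_v(z')(e)>z(e)$; it is interesting for $v$ under $x$ if it is so under $x_v$. A g-matching $x$ is *stable* if no edge is interesting under $x$ for both of its ends. Let $\mathcal S$ be the set of stable g-matchings. **Rotations.** Let $x\in\mathcal S$, and let $\mathbf 1^e$ be the unit vector of $e$. Let $U^+$ be the set of edges $wf$ ($w\in W$, $f\in F$) that are interesting for $f$ under $x$, and $U^-$ the set of edges $wf$ with $x(wf)>0$ that are not interesting for $f$ under $x$. * A *legal $F$-pair* is a pair $(a,c)$ with $a\in U^+\cap E_f$ and $c\in E_f\setminus\{a\}$, for some $f\in F$, such that $C_f(x_f+\mathbf 1^a)=x_f+\mathbf 1^a-\mathbf 1^c$. * A *legal $W$-pair* is a pair $(c,a)$ with $c\in U^-\cap E_w$ and $a\in U^+\cap E_w$, for some $w\in W$, such that $x_w+\mathbf 1^a-\mathbf 1^c$ is acceptable for $w$. It is *essential* if no $d\in (U^+\cap E_w)\setminus\{a\}$ is interesting for $w$ under $x_w+\mathbf 1^a-\mathbf 1^c$. Let $\mathcal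 D(x)$ be the directed graph that has two vertices $w^e,f^e$ for every edge $e=wf\in U^+\cup U^-$, and directed edges $(w^a,f^a)$ for $a\in U^+$, $(f^c,w^c)$ for $c\in U^-$, $(f^a,f^c)$ for legal $F$-pairs $(a,c)$, and $(w^c,w^a)$ for essential $W$-pairs $(c,a)$. Delete vertices without entering edges repeatedly until none is left. The legal $F$-pairs and essential $W$-pairs whose directed edges survive are called *tandems*. A *rotation* applicable to $x$ is a nonempty cyclic sequence $R=(e_1,\dots,e_k)$ of pairwise distinct edges of $G$ (taken up to cyclic shift) in which all the pairs $(e_i,e_{i+1})$, $i=1,\dots,k$, with $e_{k+1}:=e_1$, are tandems. Let $\mathcal R(x)$ be the set of rotations applicable to $x$. For $R\in\mathcal R(x)$ let $\chi^R\in\{0,\pm1\}^E$ take the value $1$ on the edges of $R$ in $U^+$, $-1$ on the edges of $R$ in $U^-$, and $0$ on all other edges. **Statement.** For every $x\in\mathcal S$: 1. for every $R\in\mathcal R(x)$, the vector $x+\chi^R$ is a stable g-matching and $x\prec_F x+\chi^R$; 2. for every $y\in\mathcal S$ with $x\prec_F y$ there is $R\in\mathcal R(x)$ with $x+\chi^R\preceq_F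 y$; 3. the set $\mathcal S_x$ of stable g-matchings that immediately succeed $x$ (those $y\in\mathcal S$ with $x\prec_F y$ and no $z\in\mathcal S$ with $x\prec_F z\prec_F y$) is exactly $\{x+\chi^R: R\in\mathcal R(x)\}$; 4. $\mathcal R(x)$ is finite and $|\mathcal S_x|=|\mathcal R(x)|\le |E|/4$. -/

import Mathlib

namespace SGMM

section OneAgent

/-! Vectors on a finite set `S` of contracts, and the choice function of one agent. Vectors are
integer valued; the domain is the integer box between `0` and the capacities. -/

variable {S : Type*}

/-- The integer box of all `z : S → ℤ` with `0 ≤ z ≤ b`. -/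
def box (b : S → ℕ) : Set (S → ℤ) :=
  {z | ∀ e, 0 ≤ z e ∧ z e ≤ (b e : ℤ)}

/-- The unit base vector of `e`. -/
noncomputable def unit (e : S) : S → ℤ :=
  open Classical in fun e' => if e' = e then 1 else 0

/-- `C` restricts to a map of the box into itself with `C z ≤ z`, and on the box it is consistent,
substitutable (persistent) and size monotone. Values of `C` outside the box are irrelevant. -/
structure IsChoiceFunction [Fintype S] (b : S → ℕ) (C : (S → ℤ) → (S → ℤ)) : Prop where
  mem_box : ∀ z ∈ box b, C z ∈ box b
  le_self : ∀ z ∈ box b, C z ≤ z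
  consistent : ∀ z ∈ box b, ∀ z' ∈ box b, z' ≤ z → C z ≤ z' → C z' = C z
  substitutable : ∀ z ∈ box b, ∀ z' ∈ box b, z' ≤ z → C z ⊓ z' ≤ C z'
  size_monotone : ∀ z ∈ box b, ∀ z' ∈ box b, z' ≤ z → ∑ e, C z' e ≤ ∑ e, C z e

/-- Acceptable vectors of one agent. -/
def Acceptable (b : S → ℕ) (C : (S → ℤ) → (S → ℤ)) (z : S → ℤ) : Prop :=
  z ∈ box b ∧ C z = z

/-- `RevPref b C z' z`: the acceptable vector `z` is revealed preferred to the (different)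
acceptable vector `z'`. -/
def RevPref (b : S → ℕ) (C : (S → ℤ) → (S → ℤ)) (z' z : S → ℤ) : Prop :=
  Acceptable b C z' ∧ Acceptable b C z ∧ z' ≠ z ∧ C (z ⊔ z') = z

/-- The contract `e` is interesting for the agent under `z`. -/
def Interesting (b : S → ℕ) (C : (S → ℤ) → (S → ℤ)) (z : S → ℤ) (e : S) : Prop :=
  ∃ z' ∈ box b, z e < z' e ∧ (∀ e', e' ≠ e → z' e' = z e') ∧ z e < C z' e

end OneAgent

/-- A bipartite graph without multiple edges, with colour classes `W` (workers) and `F` (firms):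
an edge is a pair `(w, f)`. -/
structure BipGraph (W F : Type*) where
  edges : Finset (W × F)

namespace BipGraph

variable {W F : Type*} (G : BipGraph W F)

/-- The edge set `E`. -/
abbrev Edge : Type _ := {e : W × F // e ∈ G.edges}

/-- The vertex `v` is an end of the edge `e`. -/
def Inc : W ⊕ F → G.Edge → Prop
  | Sum.inl w, e => e.1.1 = w
  | Sum.inr f, e => e.1.2 = f

/-- The set `E_v` of edges incident to `v`. -/
abbrev Star (v : W ⊕ F) : Type _ := {e : G.Edge // G.Inc v e}

noncomputable instance (v : W ⊕ F) : Fintype (G.Star v) :=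
  Fintype.ofFinite _

/-- The restriction of a function on `E` to `E_v`. -/
def restr {α : Type*} (x : G.Edge → α) (v : W ⊕ F) : G.Star v → α :=
  fun e => x e.1

end BipGraph

/-- An instance of the stable generalized matching model: a bipartite graph, edge capacities, and a
choice function for every vertex. -/
structure Market (W F : Type*) where
  graph : BipGraph W F
  cap : graph.Edge → ℕ
  C : ∀ v : W ⊕ F, (graph.Star v → ℤ) → (graph.Star v → ℤ)
  isChoice : ∀ v, IsChoiceFunction (graph.restr cap v) (C v)

namespace Market

variable {W F : Type*} (M : Market W F)

/-- The edge set `E` of the market. -/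
abbrev Edge : Type _ := M.graph.Edge

/-- The set `𝒜` of generalized matchings: members of the box on `E` all of whose restrictions to
the sets `E_v` are acceptable. -/
def GMatching : Set (M.Edge → ℤ) :=
  {x | x ∈ box M.cap ∧ ∀ v, Acceptable (M.graph.restr M.cap v) (M.C v) (M.graph.restr x v)}

/-- `e` is incident to the vertex `v` and interesting for `v` under `x`. -/
def InterestingFor (x : M.Edge → ℤ) (v : W ⊕ F) (e : M.Edge) : Prop :=
  ∃ h : M.graph.Inc v e, Interesting (M.graph.restr M.cap v) (M.C v) (M.graph.restr x v) ⟨e, h⟩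

/-- `e` is interesting for both of its ends. -/
def Blocking (x : M.Edge → ℤ) (e : M.Edge) : Prop :=
  M.InterestingFor x (Sum.inl e.1.1) e ∧ M.InterestingFor x (Sum.inr e.1.2) e

/-- The set `𝒮` of stable generalized matchings. -/
def Stable : Set (M.Edge → ℤ) :=
  {x | x ∈ M.GMatching ∧ ∀ e, ¬ M.Blocking x e}

/-- The relation `x ≺_F y` between generalized matchings. -/
def PrecF (x y : M.Edge → ℤ) : Prop :=
  x ∈ M.GMatching ∧ y ∈ M.GMatching ∧ x ≠ y ∧
    ∀ f : F, M.graph.restr x (Sum.inr f) = M.graph.restr y (Sum.inr f) ∨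
      RevPref (M.graph.restr M.cap (Sum.inr f)) (M.C (Sum.inr f))
        (M.graph.restr x (Sum.inr f)) (M.graph.restr y (Sum.inr f))

/-- The stable generalized matchings that immediately succeed `x` in `(𝒮, ≺_F)`. -/
def immediateSuccessors (x : M.Edge → ℤ) : Set (M.Edge → ℤ) :=
  {y | y ∈ M.Stable ∧ M.PrecF x y ∧ ¬ ∃ z ∈ M.Stable, M.PrecF x z ∧ M.PrecF z y}

/-- `U_F^+(x)`: the edges that are interesting for their ends in `F`. -/
def UPlus (x : M.Edge → ℤ) : Set M.Edge :=
  {a | M.InterestingFor x (Sum.inr a.1.2) a}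

/-- `U_F^-(x)`: the edges of positive value that are not interesting for their ends in `F`. -/
def UMinus (x : M.Edge → ℤ) : Set M.Edge :=
  {c | 0 < x c ∧ ¬ M.InterestingFor x (Sum.inr c.1.2) c}

/-- `(a, c)` is a legal `F`-pair under `x`, passing the common end `f` of `a` and `c` in `F`:
`a ∈ U_f^+`, `c ∈ E_f - {a}` and `C_f (x_f + 1^a) = x_f + 1^a - 1^c`. -/
def LegalF (x : M.Edge → ℤ) (a c : M.Edge) : Prop :=
  a ∈ M.UPlus x ∧ c.1.2 = a.1.2 ∧ c ≠ a ∧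
    M.C (Sum.inr a.1.2) (M.graph.restr (x + unit a) (Sum.inr a.1.2)) =
      M.graph.restr (x + unit a - unit c) (Sum.inr a.1.2)

/-- `(c, a)` is a legal `W`-pair under `x`, passing the common end `w` of `c` and `a` in `W`:
`c ∈ U_F^-`, `a ∈ U_F^+` and `x_w + 1^a - 1^c` is acceptable for `w`. -/
def LegalW (x : M.Edge → ℤ) (c a : M.Edge) : Prop :=
  c ∈ M.UMinus x ∧ a ∈ M.UPlus x ∧ a.1.1 = c.1.1 ∧
    Acceptable (M.graph.restr M.cap (Sum.inl c.1.1)) (M.C (Sum.inl c.1.1))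
      (M.graph.restr (x + unit a - unit c) (Sum.inl c.1.1))

/-- The legal `W`-pair `(c, a)`, passing `w`, is essential: no edge of `U_F^+ ∩ E_w` other than
`a` is interesting for `w` under `x_w + 1^a - 1^c`. (`InterestingFor` at `w` contains incidence
to `w`, and depends on its vector only through the restriction to `E_w`.) -/
def EssentialW (x : M.Edge → ℤ) (c a : M.Edge) : Prop :=
  M.LegalW x c a ∧
    ∀ d ∈ M.UPlus x, d ≠ a → ¬ M.InterestingFor (x + unit a - unit c) (Sum.inl c.1.1) d

end Market

/-- Names for the vertices of the auxiliary directed graph: an edge `e = wf` has the two copies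
`w^e = w e` and `f^e = f e` of its ends. -/
inductive AuxVertex (E : Type*) where
  | w (e : E) : AuxVertex E
  | f (e : E) : AuxVertex E

namespace Market

variable {W F : Type*} (M : Market W F)

/-- The vertices of the auxiliary directed graph `𝒟(x)`: both copies for each edge in
`U_F^+ ∪ U_F^-`. -/
def auxVertices (x : M.Edge → ℤ) : Set (AuxVertex M.Edge) :=
  {u | ∃ e ∈ M.UPlus x ∪ M.UMinus x, u = AuxVertex.w e ∨ u = AuxVertex.f e}

/-- The directed edges of `𝒟(x)`. -/
inductive AuxArc (x : M.Edge → ℤ) : AuxVertex M.Edge → AuxVertex M.Edge → Prop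
  | pos (a : M.Edge) : a ∈ M.UPlus x → AuxArc x (AuxVertex.w a) (AuxVertex.f a)
  | neg (c : M.Edge) : c ∈ M.UMinus x → AuxArc x (AuxVertex.f c) (AuxVertex.w c)
  | legal (a c : M.Edge) : M.LegalF x a c → AuxArc x (AuxVertex.f a) (AuxVertex.f c)
  | essential (c a : M.Edge) : M.EssentialW x c a → AuxArc x (AuxVertex.w c) (AuxVertex.w a)

/-- One round of the cleaning procedure: delete the vertices that no edge enters. -/
def cleanStep (x : M.Edge → ℤ) (X : Set (AuxVertex M.Edge)) : Set (AuxVertex M.Edge) :=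
  {v | v ∈ X ∧ ∃ u ∈ X, M.AuxArc x u v}

/-- The vertex set of `𝒟(x)` after the cleaning procedure has stabilized. -/
def cleaned (x : M.Edge → ℤ) : Set (AuxVertex M.Edge) :=
  ⋂ n : ℕ, (M.cleanStep x)^[n] (M.auxVertices x)

/-- The tandems of the active graph `Γ(x)`: the legal `F`-pairs and essential `W`-pairs whose
directed edges are left in `𝒟(x)` after cleaning. -/
def Tandem (x : M.Edge → ℤ) (e e' : M.Edge) : Prop :=
  (M.LegalF x e e' ∧ AuxVertex.f e ∈ M.cleaned x ∧ AuxVertex.f e' ∈ M.cleaned x) ∨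
  (M.EssentialW x e e' ∧ AuxVertex.w e ∈ M.cleaned x ∧ AuxVertex.w e' ∈ M.cleaned x)

/-- The set `ℛ(x)` of rotations applicable to `x`: the edge-simple cycles `(e_1, …, e_k)` of the
active graph in which each pair `(e_i, e_{i+1})`, as well as `(e_k, e_1)`, is a tandem. They are
sequences of edges up to cyclic shift. -/
def rotations (x : M.Edge → ℤ) : Set (Cycle M.Edge) :=
  {R | R ≠ Cycle.nil ∧ R.Nodup ∧ R.Chain (M.Tandem x)}

/-- The vector `χ^R`, with value `1` on the positive edges of `R` (those in `U_F^+`), value `-1` on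
the negative ones (those in `U_F^-`), and `0` off `R`. -/
noncomputable def chi (x : M.Edge → ℤ) (R : Cycle M.Edge) : M.Edge → ℤ :=
  open Classical in fun e =>
    if e ∈ R ∧ e ∈ M.UPlus x then 1 else if e ∈ R ∧ e ∈ M.UMinus x then -1 else 0

end Market

end SGMM

namespace SGMM

/-! ### Unit vectors, 0-1 vectors and integer boxes. -/

section OneAgent

variable {S : Type*}

/-! Both kinds of exchange are choice equations. A legal `F`-pair `(a, c)` says that `c` is what the
firm drops when offered one more unit of `a`. If `D` is `x` with every edge of `U⁺` raised to
capacity, stability of `x` gives `C_w(D_w) = x_w` (`choice_raise`), and `(c, a)` is essential iff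
`a` is what the worker takes from `D` once a unit of `c ∈ U⁻` is withdrawn (`essentialW_iff`). So
each edge has at most one successor (`Exchange.unique`), and rotations are simple cycles of a
functional relation: two that meet are equal.

The exchanges of a rotation can be made simultaneously: substitutability bounds the choice
coordinatewise and size monotonicity makes the bound an equality (`choice_add_indic`,
`choice_sub_indic`). This gives stability of `x + χ^R` and `x ≺_F x + χ^R`.

Conversely, let `y` be stable above `x`. Then `x` and `y` have equal size at every vertex
(`sum_restr_eq`). Call `a ∈ U⁺` attained if the firm, holding `y`, has no use for the extra unit in
`x + 1^a`. An attained edge has a successor `c` with `y c < x c`, and such a `c` has an attained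
successor; the endless walk closes into a rotation `R` with `x + χ^R ⪯_F y`
(`exists_rotation_weakF`).

Any matching above `x + χ^R` is strictly below `x` on the negative edges of `R`, so distinct
rotations give incomparable matchings, which are therefore exactly the immediate successors.
Rotations are disjoint and have at least four edges each, whence the bound. -/

theorem unit_self (e : S) : unit e e = 1 := by simp [unit]

theorem unit_of_ne {e e' : S} (h : e' ≠ e) : unit e e' = 0 := by simp [unit, h]

theorem unit_nonneg (e e' : S) : 0 ≤ unit e e' := by
  unfold unit; split_ifs <;> simp

theorem unit_eq_ite [DecidableEq S] (e e' : S) : unit e e' = if e' = e then 1 else 0 := by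
  unfold unit; congr

theorem unit_injective : Function.Injective (unit : S → S → ℤ) := by
  intro a c h
  by_contra hne
  have := congrFun h a
  rw [unit_self, unit_of_ne hne] at this
  exact one_ne_zero this

theorem sum_unit [Fintype S] (e : S) : ∑ e', unit e e' = 1 := by
  classical
  simp [unit_eq_ite]

/-- The 0-1 vector of a finite set. -/
noncomputable def indic (A : Finset S) : S → ℤ :=
  open Classical in fun e => if e ∈ A then 1 else 0

theorem indic_of_mem {A : Finset S} {e : S} (h : e ∈ A) : indic A e = 1 := by simp [indic, h]

theorem indic_of_notMem {A : Finset S} {e : S} (h : e ∉ A) : indic A e = 0 := by simp [indic, h]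

theorem sum_indic [Fintype S] (A : Finset S) : ∑ e, indic A e = A.card := by
  classical
  simp [indic]

theorem eq_of_le_of_sum_le [Fintype S] {u v : S → ℤ} (h : u ≤ v) (hs : ∑ e, v e ≤ ∑ e, u e) :
    u = v := by
  have h1 : ∑ e, (v e - u e) = 0 := by
    have : 0 ≤ ∑ e, (v e - u e) := Finset.sum_nonneg fun e _ => sub_nonneg.2 (h e)
    rw [Finset.sum_sub_distrib] at *
    omega
  funext e
  have := (Finset.sum_eq_zero_iff_of_nonneg fun e _ => sub_nonneg.2 (h e)).1 h1 e (Finset.mem_univ e)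
  linarith

/-- Integer vectors `u ≤ v` whose sums differ by one differ by a unit vector. -/
theorem eq_add_unit_of_le [Fintype S] {u v : S → ℤ} (h : u ≤ v)
    (hs : ∑ e, v e = ∑ e, u e + 1) : ∃ c, v = u + unit c := by
  have hex : ∃ c, u c < v c := by
    by_contra! hcon
    have : ∑ e, v e ≤ ∑ e, u e := Finset.sum_le_sum fun e _ => hcon e
    omega
  obtain ⟨c, hc⟩ := hex
  refine ⟨c, (eq_of_le_of_sum_le (fun e => ?_) ?_).symm⟩
  · by_cases he : e = c
    · subst he; simp only [Pi.add_apply, unit_self]; omega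
    · simp only [Pi.add_apply, unit_of_ne he]; have : u e ≤ v e := h e; omega
  · simp only [Pi.add_apply, Finset.sum_add_distrib, sum_unit]; omega

theorem sup_mem_box {b : S → ℕ} {u v : S → ℤ} (hu : u ∈ box b) (hv : v ∈ box b) :
    u ⊔ v ∈ box b := fun e => by
  have := hu e; have := hv e
  simp only [Pi.sup_apply]
  omega

theorem mem_box_of_le {b : S → ℕ} {l u v : S → ℤ} (hl : l ∈ box b) (hv : v ∈ box b)
    (h1 : l ≤ u) (h2 : u ≤ v) : u ∈ box b := fun e =>
  ⟨(hl e).1.trans (h1 e), (h2 e).trans (hv e).2⟩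

theorem add_unit_mem_box {b : S → ℕ} {z : S → ℤ} (hz : z ∈ box b) {e : S} (h : z e < b e) :
    z + unit e ∈ box b := fun e' => by
  have := hz e'
  by_cases he : e' = e
  · subst he; simp only [Pi.add_apply, unit_self]; omega
  · simpa [unit_of_ne he] using this

open Classical in
theorem update_mem_box {b : S → ℕ} {z v : S → ℤ} (hz : z ∈ box b) (hv : v ∈ box b) (e : S) :
    Function.update z e (v e) ∈ box b := fun e' => by
  by_cases he : e' = e
  · subst he; simpa using hv e'
  · simpa [he] using hz e'

/-! ### One choice function: interest, single exchanges, simultaneous exchanges. -/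

namespace IsChoiceFunction

variable [Fintype S] {b : S → ℕ} {C : (S → ℤ) → (S → ℤ)} (h : IsChoiceFunction b C)

include h

theorem min_le {z z' : S → ℤ} (hz : z ∈ box b) (hz' : z' ∈ box b) (hle : z' ≤ z) (e : S) :
    min (C z e) (z' e) ≤ C z' e :=
  h.substitutable z hz z' hz' hle e

theorem idem {z : S → ℤ} (hz : z ∈ box b) : C (C z) = C z :=
  h.consistent z hz _ (h.mem_box z hz) (h.le_self z hz) le_rfl

theorem acceptable {z : S → ℤ} (hz : z ∈ box b) : Acceptable b C (C z) :=
  ⟨h.mem_box z hz, h.idem hz⟩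

theorem eq_of_between {z z' u : S → ℤ} (hz : z ∈ box b) (hu : C z = u) (h1 : u ≤ z')
    (h2 : z' ≤ z) : C z' = u :=
  (h.consistent z hz z' (mem_box_of_le (hu ▸ h.mem_box z hz) hz h1 h2) h2 (hu ▸ h1)).trans hu

theorem eq_of_le {z u : S → ℤ} (hz : z ∈ box b) (hu : Acceptable b C u) (huz : u ≤ z)
    (hle : C z ≤ u) : C z = u :=
  (h.consistent z hz u hu.1 huz hle).symm.trans hu.2

/-- Substitutability gives `C (z ⊔ z') ≤ C z ⊔ z'`; consistency does the rest. -/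
theorem path_independent {z z' : S → ℤ} (hz : z ∈ box b) (hz' : z' ∈ box b) :
    C (C z ⊔ z') = C (z ⊔ z') := by
  have hb := sup_mem_box hz hz'
  refine h.consistent _ hb _ (sup_mem_box (h.mem_box z hz) hz')
    (sup_le_sup_right (h.le_self z hz) _) fun e => ?_
  have h1 := h.min_le hb hz le_sup_left e
  have h2 := h.le_self _ hb e
  simp only [Pi.sup_apply] at *
  omega

/-- By substitutability, a choice that increases `e` by several units also accepts the first one
alone. -/
theorem interesting_spec {z : S → ℤ} {e : S} (hz : Acceptable b C z) (hi : Interesting b C z e) :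
    z + unit e ∈ box b ∧ C (z + unit e) e = z e + 1 := by
  obtain ⟨z', hz', hlt, heq, hC⟩ := hi
  have hb : z + unit e ∈ box b := add_unit_mem_box hz.1 (hlt.trans_le (hz' e).2)
  have hle : z + unit e ≤ z' := fun e' => by
    by_cases he : e' = e
    · subst he; simp only [Pi.add_apply, unit_self]; omega
    · simp [unit_of_ne he, heq e' he]
  refine ⟨hb, ?_⟩
  have h1 := h.min_le hz' hb hle e
  have h2 := h.le_self _ hb e
  simp only [Pi.add_apply, unit_self] at *
  omega

open Classical in
theorem interesting_of_le {z v : S → ℤ} {e : S} (hz : z ∈ box b) (hv : v ∈ box b) (hzv : z ≤ v)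
    (hC : z e < C v e) : Interesting b C z e := by
  have hb := update_mem_box hz hv e
  have hlt : z e < v e := hC.trans_le (h.le_self v hv e)
  refine ⟨Function.update z e (v e), hb, by simpa using hlt,
    fun e' he => by simp [he], ?_⟩
  have := h.min_le hv hb (update_le_iff.2 ⟨le_rfl, fun e' _ => hzv e'⟩) e
  simp only [Function.update_self] at this
  omega

/-- With its converse below, this translates between absence of interest, which is how stability is
stated, and choice equations. A coordinate of `C v` above `z` would be interesting by
substitutability, so `C v ≤ z` and consistency applies. -/
theorem choice_eq_of_not_interesting {z v : S → ℤ} (hz : Acceptable b C z) (hv : v ∈ box b)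
    (hzv : z ≤ v) (hn : ∀ e, z e < v e → ¬ Interesting b C z e) : C v = z := by
  refine h.eq_of_le hv hz hzv fun e => ?_
  by_contra! hlt
  exact hn e (hlt.trans_le (h.le_self v hv e)) (h.interesting_of_le hz.1 hv hzv hlt)

theorem not_interesting_of_choice_eq {z v : S → ℤ} {e : S} (hv : v ∈ box b) (hC : C v = z)
    (he : z e < v e) : ¬ Interesting b C z e := by
  intro hi
  obtain ⟨-, h2⟩ := h.interesting_spec (hC ▸ h.acceptable hv) hi
  have hle : z ≤ v := hC ▸ h.le_self v hv
  rw [h.eq_of_between hv hC (fun e' => by simp [unit_nonneg]) fun e' => ?_] at h2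
  · omega
  · by_cases hee : e' = e
    · subst hee; simp only [Pi.add_apply, unit_self]; omega
    · simpa [unit_of_ne hee] using hle e'

/-- Size monotonicity allows at most one unit to be dropped, and it is not the new one. -/
theorem choice_add_unit {z : S → ℤ} {e : S} (hz : Acceptable b C z) (hi : Interesting b C z e) :
    C (z + unit e) = z + unit e ∨
      ∃ c, c ≠ e ∧ C (z + unit e) = z + unit e - unit c := by
  obtain ⟨hb, hval⟩ := h.interesting_spec hz hi
  have hle : z ≤ z + unit e := fun e' => by simp [unit_nonneg]
  have h1 := h.size_monotone _ hb _ hz.1 hle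
  rw [hz.2] at h1
  have h2 := h.le_self _ hb
  have hsum : ∑ e', (z + unit e) e' = ∑ e', z e' + 1 := by
    simp only [Pi.add_apply, Finset.sum_add_distrib, sum_unit]
  have h3 := Finset.sum_le_sum fun e' (_ : e' ∈ Finset.univ) => h2 e'
  rcases (show ∑ e', C (z + unit e) e' = ∑ e', z e' ∨
      ∑ e', C (z + unit e) e' = ∑ e', z e' + 1 by omega) with h4 | h4
  · obtain ⟨c, hc⟩ := eq_add_unit_of_le h2 (by rw [hsum, h4])
    have hc' : C (z + unit e) = z + unit e - unit c := eq_sub_of_add_eq hc.symm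
    refine Or.inr ⟨c, ?_, hc'⟩
    rintro rfl
    rw [hc'] at hval
    simp [unit_self] at hval
  · exact Or.inl (eq_of_le_of_sum_le h2 (by omega))

/-- A contract given up in favour of another one is not interesting. -/
theorem not_interesting_of_exchange {z : S → ℤ} {a c : S} (hz : Acceptable b C z)
    (hb : z + unit a ∈ box b) (hca : c ≠ a) (hC : C (z + unit a) = z + unit a - unit c) :
    0 < z c ∧ ¬ Interesting b C z c := by
  have hpos : 0 < z c := by
    have := (h.mem_box _ hb c).1
    rw [hC] at this
    simp only [Pi.add_apply, Pi.sub_apply, unit_of_ne hca, unit_self] at this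
    omega
  refine ⟨hpos, fun hi => ?_⟩
  obtain ⟨hbc, hval⟩ := h.interesting_spec hz hi
  have hbac : z + unit a + unit c ∈ box b := by
    refine add_unit_mem_box hb ?_
    have := (hbc c).2
    simp only [Pi.add_apply, unit_of_ne hca, unit_self] at this ⊢
    omega
  have hle1 : z + unit a ≤ z + unit a + unit c := fun e => by simp [unit_nonneg]
  have hle2 : z + unit c ≤ z + unit a + unit c := fun e => by
    have := unit_nonneg a e
    simp only [Pi.add_apply]; omega
  -- Already under `z + unit a` the agent keeps only `z c - 1` of `c`, so by substitutability more
  -- availability of `c` changes nothing.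
  have key : C (z + unit a + unit c) = z + unit a - unit c := by
    rw [← hC]
    refine (h.consistent _ hbac _ hb hle1 fun e => ?_).symm
    have h1 := h.le_self _ hbac e
    by_cases he : e = c
    · subst he
      have h2 := h.min_le hbac hb hle1 e
      rw [hC] at h2
      simp only [Pi.add_apply, Pi.sub_apply, unit_of_ne hca, unit_self] at h1 h2 ⊢
      omega
    · simpa [unit_of_ne he] using h1
  -- Size leaves no room to accept the unit of `c` without dropping some `d ≠ c`, but `hsub` keeps
  -- every such `d`.
  have hsz := h.size_monotone _ hbac _ hbc hle2
  rw [key] at hsz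
  have hsub : ∀ e, z e - unit c e ≤ C (z + unit c) e := fun e => by
    have := h.min_le hbac hbc hle2 e
    rw [key] at this
    have := unit_nonneg a e
    have := unit_nonneg c e
    simp only [Pi.add_apply, Pi.sub_apply] at *
    omega
  rcases h.choice_add_unit hz hi with hd | ⟨d, hdc, hd⟩
  · rw [hd] at hsz
    simp only [Pi.add_apply, Pi.sub_apply, Finset.sum_add_distrib, Finset.sum_sub_distrib,
      sum_unit] at hsz
    omega
  · have := hsub d
    rw [hd] at this
    simp only [Pi.add_apply, Pi.sub_apply, unit_self, unit_of_ne hdc] at this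
    omega

/-- Simultaneous exchanges: each contract of `B` is given up for one of `A`. -/
theorem choice_add_indic {z : S → ℤ} {A B : Finset S} (hz : Acceptable b C z)
    (hA : ∀ a ∈ A, z a < b a) (hdisj : Disjoint A B) (hcard : A.card ≤ B.card)
    (hB : ∀ c ∈ B, ∃ a ∈ A, C (z + unit a) = z + unit a - unit c) :
    z + indic A ∈ box b ∧ C (z + indic A) = z + indic A - indic B := by
  have hb : z + indic A ∈ box b := fun e => by
    have h1 := hz.1 e
    by_cases he : e ∈ A
    · have := hA e he; simp only [Pi.add_apply, indic_of_mem he]; omega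
    · simpa [indic_of_notMem he] using h1
  -- Upper bound: a unit of `B` dropped for a single `a` is dropped from the larger offer too. Size
  -- monotonicity from `z` then forces equality.
  refine ⟨hb, eq_of_le_of_sum_le (fun e => ?_) ?_⟩
  · have h1 := h.le_self _ hb e
    by_cases he : e ∈ B
    · obtain ⟨a, ha, hC⟩ := hB e he
      have heA : e ∉ A := fun h' => Finset.disjoint_left.1 hdisj h' he
      have hea : e ≠ a := fun h' => heA (h' ▸ ha)
      have h2 := h.min_le hb (add_unit_mem_box hz.1 (hA a ha)) (fun e' => by
        by_cases hee : e' = a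
        · subst hee; simp [unit_self, indic_of_mem ha]
        · have : 0 ≤ indic A e' := by unfold indic; split_ifs <;> simp
          simpa [unit_of_ne hee] using this) e
      rw [hC] at h2
      simp only [Pi.add_apply, Pi.sub_apply, unit_self, unit_of_ne hea, indic_of_mem he,
        indic_of_notMem heA] at *
      omega
    · simpa [indic_of_notMem he] using h1
  · have h1 := h.size_monotone _ hb z hz.1 fun e => by
      have : 0 ≤ indic A e := by unfold indic; split_ifs <;> simp
      simpa using this
    rw [hz.2] at h1
    simp only [Pi.add_apply, Pi.sub_apply, Finset.sum_add_distrib, Finset.sum_sub_distrib,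
      sum_indic]
    have : (A.card : ℤ) ≤ B.card := by exact_mod_cast hcard
    omega

/-- Simultaneous replacements: each contract of `A` replaces a withdrawn one of `B`. -/
theorem choice_sub_indic {z D : S → ℤ} {A B : Finset S} (hD : D ∈ box b) (hCD : C D = z)
    (hBD : ∀ c ∈ B, D c = z c) (hpos : ∀ c ∈ B, 0 < z c)
    (hdisj : Disjoint A B) (hcard : B.card ≤ A.card)
    (hA : ∀ a ∈ A, ∃ c ∈ B, C (D - unit c) = z + unit a - unit c) :
    D - indic B ∈ box b ∧ C (D - indic B) = z + indic A - indic B := by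
  have hsubbox : ∀ B' : Finset S, B' ⊆ B → D - indic B' ∈ box b := fun B' hB' e => by
    have h1 := hD e
    by_cases he : e ∈ B'
    · have := hpos e (hB' he)
      have := hBD e (hB' he)
      simp only [Pi.sub_apply, indic_of_mem he]; omega
    · simpa [indic_of_notMem he] using h1
  have hb := hsubbox B subset_rfl
  have hle : D - indic B ≤ D := fun e => by
    have : 0 ≤ indic B e := by unfold indic; split_ifs <;> simp
    simpa using this
  -- Lower bound: what is chosen from `D` or from `D - unit c` stays chosen, where still available,
  -- from the smaller offer. Size monotonicity against `D` forces equality.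
  refine ⟨hb, (eq_of_le_of_sum_le (fun e => ?_) ?_).symm⟩
  · have h1 := h.min_le hD hb hle e
    have hzD := h.le_self D hD e
    rw [hCD] at h1 hzD
    by_cases he : e ∈ A
    · obtain ⟨c, hc, hC⟩ := hA e he
      have heB : e ∉ B := fun h' => Finset.disjoint_left.1 hdisj he h'
      have hec : e ≠ c := fun h' => heB (h' ▸ hc)
      have hu : unit c = indic {c} := by
        funext e'
        by_cases hee : e' = c
        · rw [hee, unit_self, indic_of_mem (by simp)]
        · rw [unit_of_ne hee, indic_of_notMem (by simpa using hee)]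
      have hcb : D - unit c ∈ box b := hu ▸ hsubbox {c} (by simpa using hc)
      have h3 := h.le_self _ hcb e
      have h2 := h.min_le hcb hb (fun e' => by
        by_cases hee : e' = c
        · subst hee; simp [unit_self, indic_of_mem hc]
        · have : 0 ≤ indic B e' := by unfold indic; split_ifs <;> simp
          simpa [unit_of_ne hee] using this) e
      rw [hC] at h2 h3
      simp only [Pi.add_apply, Pi.sub_apply, unit_self, unit_of_ne hec, indic_of_mem he,
        indic_of_notMem heB] at *
      omega
    · by_cases heB : e ∈ B
      · have := hBD e heB
        simp only [Pi.add_apply, Pi.sub_apply, indic_of_notMem he, indic_of_mem heB] at *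
        omega
      · simp only [Pi.add_apply, Pi.sub_apply, indic_of_notMem he, indic_of_notMem heB] at *
        omega
  · have h1 := h.size_monotone _ hD _ hb hle
    rw [hCD] at h1
    simp only [Pi.add_apply, Pi.sub_apply, Finset.sum_add_distrib, Finset.sum_sub_distrib,
      sum_indic]
    have : (B.card : ℤ) ≤ A.card := by exact_mod_cast hcard
    omega

/-- Units refused one at a time are refused together, by substitutability. This is what places a
whole rotation below `y`. -/
theorem choice_sup_add_indic {x y : S → ℤ} {A : Finset S} (hx : x ∈ box b)
    (hy : Acceptable b C y) (hxy : C (y ⊔ x) = y) (hlt : ∀ a ∈ A, x a < b a)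
    (hA : ∀ a ∈ A, C (y ⊔ (x + unit a)) = y) : C (y ⊔ (x + indic A)) = y := by
  have hxA : x + indic A ∈ box b := fun e => by
    have h1 := hx e
    by_cases he : e ∈ A
    · have := hlt e he; simp only [Pi.add_apply, indic_of_mem he]; omega
    · simpa [indic_of_notMem he] using h1
  have hb := sup_mem_box hy.1 hxA
  refine h.eq_of_le hb hy le_sup_left fun e => ?_
  have h1 := h.le_self _ hb e
  by_cases he : e ∈ A
  · have h2 := h.min_le hb (sup_mem_box hy.1 (add_unit_mem_box hx (hlt e he)))
      (sup_le_sup_left (fun e' => by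
        by_cases hee : e' = e
        · subst hee; simp [unit_self, indic_of_mem he]
        · have : 0 ≤ indic A e' := by unfold indic; split_ifs <;> simp
          simpa [unit_of_ne hee] using this) _) e
    rw [hA e he] at h2
    simp only [Pi.sup_apply, Pi.add_apply, unit_self, indic_of_mem he] at *
    omega
  · have h2 := h.min_le hb (sup_mem_box hy.1 hx) (sup_le_sup_left (fun e' => by
      have : 0 ≤ indic A e' := by unfold indic; split_ifs <;> simp
      simpa using this) _) e
    rw [hxy] at h2
    simp only [Pi.sup_apply, Pi.add_apply, indic_of_notMem he] at *
    omega

theorem sup_trans {x y z : S → ℤ} (hx : x ∈ box b) (hy : y ∈ box b) (hz : z ∈ box b)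
    (hxy : C (y ⊔ x) = y) (hyz : C (z ⊔ y) = z) : C (z ⊔ (y ⊔ x)) = z := by
  rw [sup_comm, ← h.path_independent (sup_mem_box hy hx) hz, hxy, sup_comm, hyz]

end IsChoiceFunction

end OneAgent

/-! ### Simple cycles of a functional relation. -/

section Cycles

variable {α : Type*} {r : α → α → Prop}

theorem Cycle.exists_eq_cons {R : Cycle α} {e : α} (he : e ∈ R) :
    ∃ l : List α, R = ((e :: l : List α) : Cycle α) := by
  induction R using Quotient.inductionOn' with
  | h L =>
    obtain ⟨s, t, rfl⟩ := List.append_of_mem (show e ∈ L from he)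
    exact ⟨t ++ s, Quotient.sound' (List.isRotated_append)⟩

theorem Cycle.exists_succ {R : Cycle α} (hR : R.Chain r) {e : α} (he : e ∈ R) :
    ∃ e' ∈ R, r e e' := by
  obtain ⟨l, rfl⟩ := Cycle.exists_eq_cons he
  rw [Cycle.chain_coe_cons] at hR
  cases l with
  | nil => exact ⟨e, by simp, by simpa using hR⟩
  | cons y l => exact ⟨y, by simp, (List.isChain_cons_cons.1 hR).1⟩

theorem Cycle.exists_pred {R : Cycle α} (hR : R.Chain r) {e : α} (he : e ∈ R) :
    ∃ e' ∈ R, r e' e := by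
  obtain ⟨l, rfl⟩ := Cycle.exists_eq_cons he
  rw [Cycle.chain_coe_cons, ← List.cons_append, List.isChain_append] at hR
  refine ⟨(e :: l).getLast (by simp), ?_, ?_⟩
  · rw [Cycle.mem_coe_iff]; exact List.getLast_mem _
  · exact hR.2.2 _ (List.getLast_mem_getLast? _) e (by simp)

theorem Cycle.Chain.imp_of_mem {r' : α → α → Prop} {R : Cycle α}
    (h : ∀ a ∈ R, ∀ c ∈ R, r a c → r' a c) (hR : R.Chain r) : R.Chain r' := by
  induction R using Cycle.induction_on with
  | nil => trivial
  | cons a l _ =>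
    rw [Cycle.chain_coe_cons] at hR ⊢
    have hm : ∀ e ∈ a :: (l ++ [a]), e ∈ ((a :: l : List α) : Cycle α) := fun e he => by
      simp only [List.mem_cons, List.mem_append, List.not_mem_nil, or_false,
        Cycle.mem_coe_iff] at he ⊢
      tauto
    refine List.IsChain.imp_of_mem_imp (fun c d hc hd => h c (hm c hc) d (hm d hd)) hR

/-- The successor map on the members of `R` is surjective, hence injective by finiteness. -/
theorem Cycle.pred_unique [Finite α] (hr : ∀ a c c', r a c → r a c' → c = c') {R : Cycle α}
    (hR : R.Chain r) {a a' c : α} (ha : a ∈ R) (ha' : a' ∈ R) (h : r a c) (h' : r a' c) :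
    a = a' := by
  have hs : ∀ e : {e // e ∈ R}, ∃ e' : {e // e ∈ R}, r e.1 e'.1 := fun e => by
    obtain ⟨e', h1, h2⟩ := Cycle.exists_succ hR e.2
    exact ⟨⟨e', h1⟩, h2⟩
  choose σ hσ using hs
  have hsurj : Function.Surjective σ := fun e => by
    obtain ⟨e', h1, h2⟩ := Cycle.exists_pred hR e.2
    exact ⟨⟨e', h1⟩, Subtype.ext (hr _ _ _ (hσ _) h2)⟩
  have hinj := Finite.injective_iff_surjective.2 hsurj
  have : σ ⟨a, ha⟩ = σ ⟨a', ha'⟩ :=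
    Subtype.ext ((hr _ _ _ (hσ _) h).trans (hr _ _ _ (hσ ⟨a', ha'⟩) h').symm)
  exact congrArg Subtype.val (hinj this)

theorem isChain_append_unique (hr : ∀ a c c', r a c → r a c' → c = c') {e : α} :
    ∀ (x : α) (l₁ l₂ : List α), List.IsChain r (x :: (l₁ ++ [e])) →
      List.IsChain r (x :: (l₂ ++ [e])) → e ∉ l₁ → e ∉ l₂ → l₁ = l₂
  | _, [], [], _, _, _, _ => rfl
  | x, [], y :: l, h1, h2, _, h4 => by
    have := hr _ _ _ (List.isChain_cons_cons.1 h1).1 (List.isChain_cons_cons.1 h2).1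
    simp [this] at h4
  | x, y :: l, [], h1, h2, h3, _ => by
    have := hr _ _ _ (List.isChain_cons_cons.1 h1).1 (List.isChain_cons_cons.1 h2).1
    simp [this] at h3
  | x, y :: l, y' :: l', h1, h2, h3, h4 => by
    have h1 := List.isChain_cons_cons.1 h1
    have h2 := List.isChain_cons_cons.1 h2
    obtain rfl := hr _ _ _ h1.1 h2.1
    rw [isChain_append_unique hr y l l' h1.2 h2.2 (fun h => h3 (by simp [h]))
      (fun h => h4 (by simp [h]))]

/-- Simple cycles of a functional relation that meet are equal. -/
theorem Cycle.eq_of_mem_of_mem (hr : ∀ a c c', r a c → r a c' → c = c') {R R' : Cycle α}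
    (hR : R.Chain r) (hR' : R'.Chain r) (hn : R.Nodup) (hn' : R'.Nodup) {e : α}
    (he : e ∈ R) (he' : e ∈ R') : R = R' := by
  obtain ⟨l, rfl⟩ := Cycle.exists_eq_cons he
  obtain ⟨l', rfl⟩ := Cycle.exists_eq_cons he'
  rw [Cycle.chain_coe_cons] at hR hR'
  rw [Cycle.nodup_coe_iff, List.nodup_cons] at hn hn'
  rw [isChain_append_unique hr e l l' hR hR' hn.1 hn'.1]

/-- An endless path in a finite set runs into a simple cycle. -/
theorem Cycle.exists_of_forall_succ [Finite α] {Q : α → Prop} (hQ : ∃ e, Q e)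
    (hs : ∀ e, Q e → ∃ e', Q e' ∧ r e e') :
    ∃ R : Cycle α, R ≠ Cycle.nil ∧ R.Nodup ∧ R.Chain r ∧ ∀ e ∈ R, Q e := by
  classical
  obtain ⟨e₀, he₀⟩ := hQ
  choose! g hg using hs
  have hit : ∀ e, Q e → ∀ n, Q (g^[n] e) := fun e he n => by
    induction n with
    | zero => exact he
    | succ n ih => rw [Function.iterate_succ_apply']; exact (hg _ ih).1
  obtain ⟨i, j, hij, heq⟩ := Set.Finite.exists_lt_map_eq_of_forall_mem
    (t := Set.univ) (f := fun n : ℕ => g^[n] e₀) (fun _ => Set.mem_univ _) Set.finite_univ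
  have hper : g^[i] e₀ ∈ Function.periodicPts g := by
    refine Function.mk_mem_periodicPts (Nat.sub_pos_of_lt hij) ?_
    rw [Function.IsPeriodicPt, Function.IsFixedPt, ← Function.iterate_add_apply,
      Nat.sub_add_cancel hij.le]
    exact heq.symm
  have hQi := hit e₀ he₀ i
  refine ⟨Function.periodicOrbit g (g^[i] e₀), ?_, Function.nodup_periodicOrbit, ?_, ?_⟩
  · rw [Ne, Function.periodicOrbit_eq_nil_iff_not_periodic_pt, not_not]
    exact hper
  · rw [Function.periodicOrbit_chain' r hper]
    intro n
    rw [Function.iterate_succ_apply']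
    exact (hg _ (hit _ hQi n)).2
  · intro e he
    obtain ⟨n, rfl⟩ := (Function.mem_periodicOrbit_iff hper).1 he
    exact hit _ hQi n

end Cycles

/-! ### Loss of interest under improvement; essential pairs as choice equations. -/

theorem sub_unit_mem_box {S : Type*} {b : S → ℕ} {D : S → ℤ} (hD : D ∈ box b) {c : S} (hc : 0 < D c) :
    D - unit c ∈ box b := fun e => by
  have h1 := hD e
  by_cases he : e = c
  · subst he; simp only [Pi.sub_apply, unit_self]; omega
  · simpa [unit_of_ne he] using h1

namespace IsChoiceFunction

variable {S : Type*} [Fintype S] {b : S → ℕ} {C : (S → ℤ) → (S → ℤ)} (h : IsChoiceFunction b C)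

include h

/-- Interest is lost, not gained, when an agent improves. -/
theorem interesting_of_interesting {x y : S → ℤ} {e : S} (hx : x ∈ box b)
    (hy : Acceptable b C y) (hxy : C (y ⊔ x) = y) (hi : Interesting b C y e) :
    Interesting b C x e := by
  obtain ⟨hb, hval⟩ := h.interesting_spec hy hi
  have hyx := sup_mem_box hy.1 hx
  have hbig := sup_mem_box hyx hb
  have hC : C (y ⊔ x ⊔ (y + unit e)) = C (y + unit e) := by
    rw [← h.path_independent hyx hb, hxy, sup_eq_right.2]
    exact fun e' => by simp [unit_nonneg]
  refine h.interesting_of_le hx hbig (le_sup_right.trans le_sup_left) ?_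
  have h1 := h.min_le hbig hyx le_sup_left e
  rw [hxy] at h1
  rw [hC] at h1 ⊢
  rw [hval] at h1 ⊢
  simp only [Pi.sup_apply] at h1
  omega

/-- The only contract of interest after `c` is replaced by `a` being `a` itself amounts to `a`
being the replacement chosen for `c` when all contracts of `U` are fully available. -/
theorem essential_iff {z D : S → ℤ} {U : Set S} (hD : D ∈ box b)
    (hCD : C D = z) (hU : ∀ e, e ∈ U ↔ z e < D e) {a c : S} (hc : 0 < z c) (hcU : c ∉ U) :
    (a ∈ U ∧ Acceptable b C (z + unit a - unit c) ∧
      ∀ d ∈ U, d ≠ a → ¬ Interesting b C (z + unit a - unit c) d) ↔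
    C (D - unit c) = z + unit a - unit c := by
  have hzD : ∀ e, z e ≤ D e := hCD ▸ h.le_self D hD
  have hDc : D c = z c := le_antisymm (not_lt.1 fun h' => hcU ((hU c).2 h')) (hzD c)
  have hb : D - unit c ∈ box b := sub_unit_mem_box hD (by omega)
  constructor
  · rintro ⟨haU, hacc, hness⟩
    have hac : a ≠ c := fun h' => hcU (h' ▸ haU)
    have haD := (hU a).1 haU
    refine h.choice_eq_of_not_interesting hacc hb (fun e => ?_) fun e he hi => ?_
    · by_cases hea : e = a
      · subst hea
        simp only [Pi.add_apply, Pi.sub_apply, unit_self]; omega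
      · have := hzD e
        simp only [Pi.add_apply, Pi.sub_apply, unit_of_ne hea]; omega
    · by_cases hea : e = a
      -- Essentiality does not exclude further interest in `a` itself. If there were any, all of `z
      -- - unit c` plus two units of `a` would be chosen, one unit more than `C D = z` allows.
      · subst hea
        obtain ⟨hvb, hval⟩ := h.interesting_spec hacc hi
        simp only [Pi.add_apply, Pi.sub_apply, unit_self, unit_of_ne hac] at he hval
        have hvD : z + unit e - unit c + unit e ≤ D := fun e' => by
          have := hzD e'
          have := unit_nonneg c e'
          by_cases hee : e' = e
          · subst hee
            simp only [Pi.add_apply, Pi.sub_apply, unit_self, unit_of_ne hac]; omega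
          · simp only [Pi.add_apply, Pi.sub_apply, unit_of_ne hee]; omega
        have hsz := h.size_monotone _ hD _ hvb hvD
        have hge : z + unit e - unit c + unit e ≤ C (z + unit e - unit c + unit e) := fun e' => by
          have h1 := h.min_le hD hvb hvD e'
          rw [hCD] at h1
          by_cases hee : e' = e
          · subst hee
            rw [hval]
            simp only [Pi.add_apply, Pi.sub_apply, unit_self, unit_of_ne hac]; omega
          · have := unit_nonneg c e'
            simp only [Pi.add_apply, Pi.sub_apply, unit_of_ne hee] at h1 ⊢; omega
        have hs2 := Finset.sum_le_sum fun e' (_ : e' ∈ Finset.univ) => hge e'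
        rw [hCD] at hsz
        simp only [Pi.add_apply, Pi.sub_apply, Finset.sum_add_distrib, Finset.sum_sub_distrib,
          sum_unit] at hs2 hsz
        omega
      · refine hness e ((hU e).2 ?_) hea hi
        simp only [Pi.add_apply, Pi.sub_apply, unit_of_ne hea] at he
        omega
  · intro hC
    have hle := h.le_self _ hb
    rw [hC] at hle
    have hac : a ≠ c := by
      rintro rfl
      have := hle a
      simp only [Pi.add_apply, Pi.sub_apply, unit_self] at this
      omega
    refine ⟨(hU a).2 ?_, hC ▸ h.acceptable hb, fun d hd hda => ?_⟩
    · have := hle a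
      simp only [Pi.add_apply, Pi.sub_apply, unit_self, unit_of_ne hac] at this
      omega
    · refine h.not_interesting_of_choice_eq hb hC ?_
      have := (hU d).1 hd
      simp only [Pi.add_apply, Pi.sub_apply, unit_of_ne hda]
      omega

end IsChoiceFunction

/-! ### Stars of the market, the raised vector and the firms' order. -/

namespace Market

variable {W F : Type*} {M : Market W F} {x y z : M.Edge → ℤ}

open BipGraph

theorem restr_add_unit {v : W ⊕ F} (a : M.graph.Star v) :
    M.graph.restr (x + unit a.1) v = M.graph.restr x v + unit a := by
  funext e
  by_cases h : e = a
  · subst h; simp [restr, unit_self]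
  · simp [restr, unit_of_ne h, unit_of_ne (fun h' => h (Subtype.ext h') : e.1 ≠ a.1)]

theorem restr_sub_unit {v : W ⊕ F} (a : M.graph.Star v) :
    M.graph.restr (x - unit a.1) v = M.graph.restr x v - unit a := by
  funext e
  by_cases h : e = a
  · subst h; simp [restr, unit_self]
  · simp [restr, unit_of_ne h, unit_of_ne (fun h' => h (Subtype.ext h') : e.1 ≠ a.1)]

theorem interestingFor_iff {v : W ⊕ F} (e : M.graph.Star v) :
    M.InterestingFor x v e.1 ↔
      Interesting (M.graph.restr M.cap v) (M.C v) (M.graph.restr x v) e :=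
  ⟨fun ⟨_, h⟩ => h, fun h => ⟨e.2, h⟩⟩

theorem mem_UPlus_iff {f : F} (e : M.graph.Star (Sum.inr f)) :
    e.1 ∈ M.UPlus x ↔ Interesting (M.graph.restr M.cap (Sum.inr f)) (M.C (Sum.inr f))
      (M.graph.restr x (Sum.inr f)) e := by
  obtain ⟨e, rfl⟩ := e
  exact interestingFor_iff (v := Sum.inr e.1.2) ⟨e, rfl⟩

theorem mem_UMinus_iff {f : F} (e : M.graph.Star (Sum.inr f)) :
    e.1 ∈ M.UMinus x ↔ 0 < x e.1 ∧ ¬ Interesting (M.graph.restr M.cap (Sum.inr f))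
      (M.C (Sum.inr f)) (M.graph.restr x (Sum.inr f)) e :=
  and_congr_right fun _ => not_congr (mem_UPlus_iff e)

theorem notMem_UPlus_of_mem_UMinus {e : M.Edge} (h : e ∈ M.UMinus x) : e ∉ M.UPlus x := h.2

theorem legalF_iff {f : F} (a c : M.graph.Star (Sum.inr f)) :
    M.LegalF x a.1 c.1 ↔ a.1 ∈ M.UPlus x ∧ c ≠ a ∧
      M.C (Sum.inr f) (M.graph.restr x (Sum.inr f) + unit a) =
        M.graph.restr x (Sum.inr f) + unit a - unit c := by
  have h1 := restr_add_unit (x := x) a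
  have h2 := restr_sub_unit (x := x + unit a.1) c
  rw [h1] at h2
  rw [← h2, ← h1]
  obtain ⟨a, rfl⟩ := a
  obtain ⟨c, hc⟩ := c
  unfold LegalF
  refine and_congr_right fun _ => ?_
  exact ⟨fun h => ⟨fun h' => h.2.1 (congrArg Subtype.val h'), h.2.2⟩,
    fun h => ⟨hc, fun h' => h.1 (Subtype.ext h'), h.2⟩⟩

theorem box_restr (hx : x ∈ box M.cap) (v : W ⊕ F) :
    M.graph.restr x v ∈ box (M.graph.restr M.cap v) :=
  fun e => ⟨(hx e.1).1, (hx e.1).2⟩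

theorem lt_cap_of_mem_UPlus {a : M.Edge} (ha : a ∈ M.UPlus x) :
    x a < M.cap a := by
  obtain ⟨_, z, hz, h1, -⟩ := ha
  exact h1.trans_le (hz _).2

/-- The definition of a legal `F`-pair puts no such condition on `c`; it follows from
`not_interesting_of_exchange` and makes rotations alternate in sign. -/
theorem LegalF.mem_UMinus (hx : x ∈ M.GMatching) {a c : M.Edge} (h : M.LegalF x a c) :
    c ∈ M.UMinus x := by
  have hc := h.2.1
  have hl := (legalF_iff (M := M) (x := x) (f := a.1.2) ⟨a, rfl⟩ ⟨c, hc⟩).1 h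
  have hA := M.isChoice (Sum.inr a.1.2)
  have := hA.not_interesting_of_exchange (hx.2 _)
    (hA.interesting_spec (hx.2 _) ((mem_UPlus_iff (f := a.1.2) ⟨a, rfl⟩).1 h.1)).1 hl.2.1 hl.2.2
  exact (mem_UMinus_iff (f := a.1.2) ⟨c, hc⟩).2 this

open Classical in
/-- `x` with all edges that are interesting for their firms raised to their capacities. -/
noncomputable def raise (M : Market W F) (x : M.Edge → ℤ) : M.Edge → ℤ :=
  fun e => if e ∈ M.UPlus x then M.cap e else x e

theorem raise_of_mem {e : M.Edge} (h : e ∈ M.UPlus x) : M.raise x e = M.cap e := by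
  simp [raise, h]

theorem raise_of_notMem {e : M.Edge} (h : e ∉ M.UPlus x) : M.raise x e = x e := by
  simp [raise, h]

theorem raise_mem_box (hx : x ∈ box M.cap) : M.raise x ∈ box M.cap := fun e => by
  by_cases h : e ∈ M.UPlus x
  · rw [raise_of_mem h]; have := hx e; omega
  · rw [raise_of_notMem h]; exact hx e

theorem le_raise (hx : x ∈ box M.cap) (e : M.Edge) : x e ≤ M.raise x e := by
  by_cases h : e ∈ M.UPlus x
  · rw [raise_of_mem h]; exact (hx e).2
  · rw [raise_of_notMem h]

theorem mem_UPlus_of_lt_raise {e : M.Edge} (h : x e < M.raise x e) : e ∈ M.UPlus x := by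
  by_contra hn
  rw [raise_of_notMem hn] at h
  exact lt_irrefl _ h

theorem mem_UPlus_iff_lt_raise {e : M.Edge} :
    e ∈ M.UPlus x ↔ x e < M.raise x e :=
  ⟨fun h => by rw [raise_of_mem h]; exact lt_cap_of_mem_UPlus h, mem_UPlus_of_lt_raise⟩

/-- Only edges interesting for their firms are raised, and stability makes these uninteresting for
the worker. -/
theorem choice_raise (hx : x ∈ M.Stable) (w : W) :
    M.C (Sum.inl w) (M.graph.restr (M.raise x) (Sum.inl w)) = M.graph.restr x (Sum.inl w) := by
  refine (M.isChoice _).choice_eq_of_not_interesting (hx.1.2 _)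
    (box_restr (raise_mem_box hx.1.1) _) (fun e => le_raise hx.1.1 e.1) fun e he hi => ?_
  have hU : e.1 ∈ M.UPlus x := mem_UPlus_of_lt_raise he
  obtain ⟨e, rfl⟩ := e
  exact hx.2 e ⟨⟨rfl, hi⟩, hU⟩

theorem essentialW_iff (hx : x ∈ M.Stable) {w : W} (c a : M.graph.Star (Sum.inl w)) :
    M.EssentialW x c.1 a.1 ↔ c.1 ∈ M.UMinus x ∧
      M.C (Sum.inl w) (M.graph.restr (M.raise x) (Sum.inl w) - unit c) =
        M.graph.restr x (Sum.inl w) + unit a - unit c := by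
  have hdef : M.EssentialW x c.1 a.1 ↔ (c.1 ∈ M.UMinus x ∧ a.1 ∈ M.UPlus x ∧
      Acceptable (M.graph.restr M.cap (Sum.inl w)) (M.C (Sum.inl w))
        (M.graph.restr x (Sum.inl w) + unit a - unit c)) ∧
      ∀ d : M.graph.Star (Sum.inl w), d.1 ∈ M.UPlus x → d ≠ a →
        ¬ Interesting (M.graph.restr M.cap (Sum.inl w)) (M.C (Sum.inl w))
          (M.graph.restr x (Sum.inl w) + unit a - unit c) d := by
    have h1 := restr_add_unit (x := x) a
    have h2 := restr_sub_unit (x := x + unit a.1) c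
    rw [h1] at h2
    rw [← h2]
    obtain ⟨c, rfl⟩ := c
    obtain ⟨a, ha⟩ := a
    unfold EssentialW LegalW
    refine and_congr ⟨fun h => ⟨h.1, h.2.1, h.2.2.2⟩, fun h => ⟨h.1, h.2.1, ha, h.2.2⟩⟩
      ⟨fun h d hd hda hi => h d.1 hd (fun h' => hda (Subtype.ext h')) ⟨d.2, hi⟩,
        fun h d hd hda => ?_⟩
    rintro ⟨hdw, hi⟩
    exact h ⟨d, hdw⟩ hd (fun h' => hda (congrArg Subtype.val h')) hi
  rw [hdef]
  refine ⟨fun h => ⟨h.1.1, ?_⟩, fun h => ?_⟩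
  all_goals
    have hc := h.1
  · exact ((M.isChoice (Sum.inl w)).essential_iff (U := {e | e.1 ∈ M.UPlus x})
      (box_restr (raise_mem_box hx.1.1) _) (choice_raise hx w) (fun e => mem_UPlus_iff_lt_raise)
      hc.1.1 (notMem_UPlus_of_mem_UMinus hc.1)).1 ⟨hc.2.1, hc.2.2, h.2⟩
  · have := ((M.isChoice (Sum.inl w)).essential_iff (U := {e | e.1 ∈ M.UPlus x})
      (box_restr (raise_mem_box hx.1.1) _) (choice_raise hx w) (fun e => mem_UPlus_iff_lt_raise)
      hc.1 (notMem_UPlus_of_mem_UMinus hc)).2 h.2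
    exact ⟨⟨hc, this.1, this.2.1⟩, this.2.2⟩

/-- The weak relation `x ⪯_F y`, expressed by the choice functions of the firms. -/
def WeakF (M : Market W F) (x y : M.Edge → ℤ) : Prop :=
  ∀ f : F, M.C (Sum.inr f) (M.graph.restr y (Sum.inr f) ⊔ M.graph.restr x (Sum.inr f)) =
    M.graph.restr y (Sum.inr f)

theorem precF_iff :
    M.PrecF x y ↔ x ∈ M.GMatching ∧ y ∈ M.GMatching ∧ x ≠ y ∧ M.WeakF x y := by
  refine and_congr_right fun hx => and_congr_right fun hy => and_congr_right fun _ =>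
    forall_congr' fun f => ?_
  constructor
  · rintro (h | h)
    · rw [h, sup_idem, (hy.2 _).2]
    · exact h.2.2.2
  · intro h
    by_cases he : M.graph.restr x (Sum.inr f) = M.graph.restr y (Sum.inr f)
    · exact Or.inl he
    · exact Or.inr ⟨hx.2 _, hy.2 _, he, h⟩

theorem WeakF.refl (hx : x ∈ M.GMatching) : M.WeakF x x := fun f => by
  rw [sup_idem, (hx.2 _).2]

theorem WeakF.trans (hx : x ∈ M.GMatching) (hy : y ∈ M.GMatching) (hz : z ∈ M.GMatching)
    (hxy : M.WeakF x y) (hyz : M.WeakF y z) : M.WeakF x z := fun f => by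
  have hA := M.isChoice (Sum.inr f)
  refine hA.eq_of_between
    (sup_mem_box (hz.2 _).1 (sup_mem_box (hy.2 _).1 (hx.2 _).1))
    (hA.sup_trans (hx.2 _).1 (hy.2 _).1 (hz.2 _).1 (hxy f) (hyz f)) le_sup_left
    (sup_le_sup_left le_sup_right _)

theorem ext_firms (h : ∀ f : F, M.graph.restr x (Sum.inr f) = M.graph.restr y (Sum.inr f)) :
    x = y := by
  funext e
  exact congrFun (h e.1.2) ⟨e, rfl⟩

theorem WeakF.antisymm (hxy : M.WeakF x y) (hyx : M.WeakF y x) : x = y :=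
  ext_firms fun f => by rw [← hyx f, sup_comm, hxy f]

/-! ### The exchange relation and disjointness of rotations. -/

/-- The legal `F`-pairs and essential `W`-pairs. -/
def Exchange (M : Market W F) (x : M.Edge → ℤ) (e e' : M.Edge) : Prop :=
  M.LegalF x e e' ∨ M.EssentialW x e e'

theorem Exchange.mem (hx : x ∈ M.GMatching) {e e' : M.Edge} (h : M.Exchange x e e') :
    (e ∈ M.UPlus x ∧ e' ∈ M.UMinus x ∧ M.LegalF x e e') ∨
      (e ∈ M.UMinus x ∧ e' ∈ M.UPlus x ∧ M.EssentialW x e e') :=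
  h.imp (fun h => ⟨h.1, h.mem_UMinus hx, h⟩) fun h => ⟨h.1.1, h.1.2.1, h⟩

/-- The sign of the first edge fixes the kind of pair, and the choice equation then determines the
second edge. -/
theorem Exchange.unique (hx : x ∈ M.Stable) (a c c' : M.Edge) (h : M.Exchange x a c)
    (h' : M.Exchange x a c') : c = c' := by
  rcases h.mem hx.1 with ⟨h1, -, h⟩ | ⟨h1, -, h⟩ <;>
    rcases h'.mem hx.1 with ⟨h1', -, h'⟩ | ⟨h1', -, h'⟩
  · have e1 := ((legalF_iff (f := a.1.2) ⟨a, rfl⟩ ⟨c, h.2.1⟩).1 h).2.2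
    have e2 := ((legalF_iff (f := a.1.2) ⟨a, rfl⟩ ⟨c', h'.2.1⟩).1 h').2.2
    exact congrArg Subtype.val (unit_injective (sub_right_injective (e1.symm.trans e2)))
  · exact absurd h1 h1'.2
  · exact absurd h1' h1.2
  · have e1 := ((essentialW_iff hx (w := a.1.1) ⟨a, rfl⟩ ⟨c, h.1.2.2.1⟩).1 h).2
    have e2 := ((essentialW_iff hx (w := a.1.1) ⟨a, rfl⟩ ⟨c', h'.1.2.2.1⟩).1 h').2
    exact congrArg Subtype.val
      (unit_injective (add_right_injective _ (sub_left_injective (e1.symm.trans e2))))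

theorem chain_exchange {R : Cycle M.Edge} (hR : R ∈ M.rotations x) : R.Chain (M.Exchange x) :=
  Cycle.Chain.imp (fun _ _ h => h.imp And.left And.left) hR.2.2

theorem rotations_eq_of_mem (hx : x ∈ M.Stable) {R R' : Cycle M.Edge}
    (hR : R ∈ M.rotations x) (hR' : R' ∈ M.rotations x) {e : M.Edge} (he : e ∈ R)
    (he' : e ∈ R') : R = R' :=
  Cycle.eq_of_mem_of_mem (Exchange.unique hx) (chain_exchange hR) (chain_exchange hR')
    hR.2.1 hR'.2.1 he he'

theorem exists_legalF (hx : x ∈ M.GMatching) {R : Cycle M.Edge} (hR : R ∈ M.rotations x)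
    {a : M.Edge} (ha : a ∈ R) (haU : a ∈ M.UPlus x) :
    ∃ c ∈ R, c ∈ M.UMinus x ∧ M.LegalF x a c := by
  obtain ⟨c, hc, h⟩ := Cycle.exists_succ (chain_exchange hR) ha
  rcases h.mem hx with h | h
  · exact ⟨c, hc, h.2⟩
  · exact absurd haU h.1.2

theorem exists_essentialW (hx : x ∈ M.GMatching) {R : Cycle M.Edge} (hR : R ∈ M.rotations x)
    {c : M.Edge} (hc : c ∈ R) (hcU : c ∈ M.UMinus x) :
    ∃ a ∈ R, a ∈ M.UPlus x ∧ M.EssentialW x c a := by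
  obtain ⟨a, ha, h⟩ := Cycle.exists_succ (chain_exchange hR) hc
  rcases h.mem hx with h | h
  · exact absurd h.1 hcU.2
  · exact ⟨a, ha, h.2⟩

theorem exists_legalF_to (hx : x ∈ M.GMatching) {R : Cycle M.Edge} (hR : R.Chain (M.Exchange x))
    {c : M.Edge} (hc : c ∈ R) (hcU : c ∈ M.UMinus x) :
    ∃ a ∈ R, a ∈ M.UPlus x ∧ M.LegalF x a c := by
  obtain ⟨a, ha, h⟩ := Cycle.exists_pred hR hc
  rcases h.mem hx with h | h
  · exact ⟨a, ha, h.1, h.2.2⟩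
  · exact absurd h.2.1 hcU.2

theorem exists_essentialW_to (hx : x ∈ M.GMatching) {R : Cycle M.Edge}
    (hR : R.Chain (M.Exchange x)) {a : M.Edge} (ha : a ∈ R) (haU : a ∈ M.UPlus x) :
    ∃ c ∈ R, c ∈ M.UMinus x ∧ M.EssentialW x c a := by
  obtain ⟨c, hc, h⟩ := Cycle.exists_pred hR ha
  rcases h.mem hx with h | h
  · exact absurd haU h.2.1.2
  · exact ⟨c, hc, h.1, h.2.2⟩

theorem mem_UPlus_or_mem_UMinus (hx : x ∈ M.GMatching) {R : Cycle M.Edge}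
    (hR : R.Chain (M.Exchange x)) {e : M.Edge} (he : e ∈ R) :
    e ∈ M.UPlus x ∨ e ∈ M.UMinus x := by
  obtain ⟨c, -, h⟩ := Cycle.exists_succ hR he
  exact (h.mem hx).imp And.left And.left

theorem exists_mem_rotation {R : Cycle M.Edge} (hR : R ≠ Cycle.nil) : ∃ e, e ∈ R := by
  classical
  by_contra! h
  exact hR (Cycle.toFinset_eq_nil.1 (Finset.eq_empty_of_forall_notMem fun e he =>
    h e (by induction R using Quotient.inductionOn' with
      | h L => exact List.mem_toFinset.1 he)))

theorem exists_mem_UPlus (hx : x ∈ M.GMatching) {R : Cycle M.Edge} (hR : R ∈ M.rotations x) :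
    ∃ a ∈ R, a ∈ M.UPlus x := by
  obtain ⟨e, he⟩ := exists_mem_rotation hR.1
  rcases mem_UPlus_or_mem_UMinus hx (chain_exchange hR) he with h | h
  · exact ⟨e, he, h⟩
  · obtain ⟨a, ha, haU, -⟩ := exists_essentialW hx hR he h
    exact ⟨a, ha, haU⟩

/-! ### Applying a rotation. -/

theorem chi_of_UPlus {R : Cycle M.Edge} {e : M.Edge} (he : e ∈ R) (hU : e ∈ M.UPlus x) :
    M.chi x R e = 1 := by simp [chi, he, hU]

theorem chi_of_UMinus {R : Cycle M.Edge} {e : M.Edge} (he : e ∈ R) (hU : e ∈ M.UMinus x) :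
    M.chi x R e = -1 := by simp [chi, he, hU, notMem_UPlus_of_mem_UMinus hU]

theorem chi_of_notMem {R : Cycle M.Edge} {e : M.Edge} (he : e ∉ R) :
    M.chi x R e = 0 := by simp [chi, he]

open Classical in
/-- The edges at `v` that are increased by the rotation. -/
noncomputable def posAt (M : Market W F) (x : M.Edge → ℤ) (R : Cycle M.Edge) (v : W ⊕ F) :
    Finset (M.graph.Star v) := {e | e.1 ∈ R ∧ e.1 ∈ M.UPlus x}

open Classical in
/-- The edges at `v` that are decreased by the rotation. -/
noncomputable def negAt (M : Market W F) (x : M.Edge → ℤ) (R : Cycle M.Edge) (v : W ⊕ F) :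
    Finset (M.graph.Star v) := {e | e.1 ∈ R ∧ e.1 ∈ M.UMinus x}

theorem mem_posAt {R : Cycle M.Edge} {v : W ⊕ F} {e : M.graph.Star v} :
    e ∈ M.posAt x R v ↔ e.1 ∈ R ∧ e.1 ∈ M.UPlus x := by simp [posAt]

theorem mem_negAt {R : Cycle M.Edge} {v : W ⊕ F} {e : M.graph.Star v} :
    e ∈ M.negAt x R v ↔ e.1 ∈ R ∧ e.1 ∈ M.UMinus x := by simp [negAt]

theorem disjoint_posAt_negAt {R : Cycle M.Edge} {v : W ⊕ F} :
    Disjoint (M.posAt x R v) (M.negAt x R v) :=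
  Finset.disjoint_left.2 fun _ h1 h2 => (mem_negAt.1 h2).2.2 (mem_posAt.1 h1).2

theorem restr_add_chi (hx : x ∈ M.GMatching) {R : Cycle M.Edge} (hR : R ∈ M.rotations x)
    (v : W ⊕ F) : M.graph.restr (x + M.chi x R) v =
      M.graph.restr x v + indic (M.posAt x R v) - indic (M.negAt x R v) := by
  funext e
  simp only [restr, Pi.add_apply, Pi.sub_apply]
  by_cases he : e.1 ∈ R
  · rcases mem_UPlus_or_mem_UMinus hx (chain_exchange hR) he with hU | hU
    · rw [chi_of_UPlus he hU, indic_of_mem (mem_posAt.2 ⟨he, hU⟩),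
        indic_of_notMem fun h => (mem_negAt.1 h).2.2 hU]
      ring
    · rw [chi_of_UMinus he hU, indic_of_mem (mem_negAt.2 ⟨he, hU⟩),
        indic_of_notMem fun h => hU.2 (mem_posAt.1 h).2]
      ring
  · rw [chi_of_notMem he, indic_of_notMem fun h => he (mem_posAt.1 h).1,
      indic_of_notMem fun h => he (mem_negAt.1 h).1]
    ring

/-- Passing to the successor is injective along a rotation. This supplies the cardinality hypotheses
of the simultaneous exchange lemmas. -/
theorem card_le_card_of_exchange (hx : x ∈ M.Stable) {R : Cycle M.Edge}
    (hR : R ∈ M.rotations x) {v : W ⊕ F} {A B : Finset (M.graph.Star v)}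
    (hA : ∀ a ∈ A, a.1 ∈ R ∧ ∃ c ∈ B, M.Exchange x a.1 c.1) : A.card ≤ B.card := by
  choose! σ hσ using fun a ha => (hA a ha).2
  refine Finset.card_le_card_of_injOn σ (fun a ha => (hσ a ha).1) fun a ha a' ha' h => ?_
  refine Subtype.ext (Cycle.pred_unique (Exchange.unique hx) (chain_exchange hR)
    (hA a ha).1 (hA a' ha').1 (hσ a ha).2 ?_)
  rw [h]
  exact (hσ a' ha').2

theorem choice_firm_rotation (hx : x ∈ M.Stable) {R : Cycle M.Edge} (hR : R ∈ M.rotations x)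
    (f : F) :
    M.graph.restr x (Sum.inr f) + indic (M.posAt x R (Sum.inr f)) ∈
        box (M.graph.restr M.cap (Sum.inr f)) ∧
      M.C (Sum.inr f) (M.graph.restr x (Sum.inr f) + indic (M.posAt x R (Sum.inr f))) =
        M.graph.restr (x + M.chi x R) (Sum.inr f) := by
  rw [restr_add_chi hx.1 hR]
  refine (M.isChoice _).choice_add_indic (hx.1.2 _)
    (fun a ha => lt_cap_of_mem_UPlus (mem_posAt.1 ha).2) disjoint_posAt_negAt
    (card_le_card_of_exchange hx hR fun a ha => ⟨(mem_posAt.1 ha).1, ?_⟩) fun c hc => ?_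
  · obtain ⟨c, hc, hcU, h⟩ := exists_legalF hx.1 hR (mem_posAt.1 ha).1 (mem_posAt.1 ha).2
    exact ⟨⟨c, h.2.1.trans a.2⟩, mem_negAt.2 ⟨hc, hcU⟩, Or.inl h⟩
  · obtain ⟨a, ha, haU, h⟩ := exists_legalF_to hx.1 (chain_exchange hR) (mem_negAt.1 hc).1
      (mem_negAt.1 hc).2
    exact ⟨⟨a, h.2.1.symm.trans c.2⟩, mem_posAt.2 ⟨ha, haU⟩, ((legalF_iff _ _).1 h).2.2⟩

theorem choice_worker_rotation (hx : x ∈ M.Stable) {R : Cycle M.Edge} (hR : R ∈ M.rotations x)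
    (w : W) :
    M.graph.restr (M.raise x) (Sum.inl w) - indic (M.negAt x R (Sum.inl w)) ∈
        box (M.graph.restr M.cap (Sum.inl w)) ∧
      M.C (Sum.inl w)
          (M.graph.restr (M.raise x) (Sum.inl w) - indic (M.negAt x R (Sum.inl w))) =
        M.graph.restr (x + M.chi x R) (Sum.inl w) := by
  rw [restr_add_chi hx.1 hR]
  refine (M.isChoice _).choice_sub_indic (box_restr (raise_mem_box hx.1.1) _)
    (choice_raise hx w) (fun c hc => raise_of_notMem (mem_negAt.1 hc).2.2)
    (fun c hc => (mem_negAt.1 hc).2.1) disjoint_posAt_negAt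
    (card_le_card_of_exchange hx hR fun c hc => ⟨(mem_negAt.1 hc).1, ?_⟩) fun a ha => ?_
  · obtain ⟨a, ha, haU, h⟩ := exists_essentialW hx.1 hR (mem_negAt.1 hc).1 (mem_negAt.1 hc).2
    exact ⟨⟨a, h.1.2.2.1.trans c.2⟩, mem_posAt.2 ⟨ha, haU⟩, Or.inr h⟩
  · obtain ⟨c, hc, hcU, h⟩ := exists_essentialW_to hx.1 (chain_exchange hR) (mem_posAt.1 ha).1
      (mem_posAt.1 ha).2
    exact ⟨⟨c, h.1.2.2.1.symm.trans a.2⟩, mem_negAt.2 ⟨hc, hcU⟩,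
      ((essentialW_iff hx _ _).1 h).2⟩

theorem weakF_add_chi (hx : x ∈ M.Stable) {R : Cycle M.Edge} (hR : R ∈ M.rotations x) :
    M.WeakF x (x + M.chi x R) := fun f => by
  obtain ⟨hb, hC⟩ := choice_firm_rotation hx hR f
  have hle := (M.isChoice _).le_self _ hb
  rw [hC] at hle
  refine (M.isChoice _).eq_of_between hb hC le_sup_left (sup_le hle fun e => ?_)
  have : 0 ≤ indic (M.posAt x R (Sum.inr f)) e := by unfold indic; split_ifs <;> simp
  simpa using this

theorem add_chi_mem_GMatching (hx : x ∈ M.Stable) {R : Cycle M.Edge}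
    (hR : R ∈ M.rotations x) : x + M.chi x R ∈ M.GMatching := by
  have hacc : ∀ v, Acceptable (M.graph.restr M.cap v) (M.C v)
      (M.graph.restr (x + M.chi x R) v) := by
    rintro (w | f)
    · obtain ⟨hb, hC⟩ := choice_worker_rotation hx hR w
      exact hC ▸ (M.isChoice _).acceptable hb
    · obtain ⟨hb, hC⟩ := choice_firm_rotation hx hR f
      exact hC ▸ (M.isChoice _).acceptable hb
  exact ⟨fun e => (hacc (Sum.inr e.1.2)).1 ⟨e, rfl⟩, hacc⟩

/-- Firms improve, so an edge interesting for its firm now was so under `x` and is at capacity in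
`raise`. The worker chooses `x + χ^R` from the raised vector less the negative edges, so has no
interest in it. -/
theorem add_chi_mem_Stable (hx : x ∈ M.Stable) {R : Cycle M.Edge}
    (hR : R ∈ M.rotations x) : x + M.chi x R ∈ M.Stable := by
  have hG := add_chi_mem_GMatching hx hR
  refine ⟨hG, fun e ⟨hw, hf⟩ => ?_⟩
  have hU : e ∈ M.UPlus x := (mem_UPlus_iff (f := e.1.2) ⟨e, rfl⟩).2
    ((M.isChoice _).interesting_of_interesting (hx.1.2 _).1 (hG.2 _) (weakF_add_chi hx hR _)
      ((mem_UPlus_iff (f := e.1.2) ⟨e, rfl⟩).1 hf))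
  obtain ⟨hb, hC⟩ := choice_worker_rotation hx hR e.1.1
  refine (M.isChoice _).not_interesting_of_choice_eq hb hC ?_
    ((interestingFor_iff (v := Sum.inl e.1.1) ⟨e, rfl⟩).1 hw)
  have h1 : (x + M.chi x R) e < M.cap e := lt_cap_of_mem_UPlus hf
  have h2 : (⟨e, rfl⟩ : M.graph.Star (Sum.inl e.1.1)) ∉ M.negAt x R (Sum.inl e.1.1) :=
    fun h => (mem_negAt.1 h).2.2 hU
  rw [Pi.sub_apply, indic_of_notMem h2]
  simpa [restr, raise_of_mem hU] using h1

theorem precF_add_chi (hx : x ∈ M.Stable) {R : Cycle M.Edge}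
    (hR : R ∈ M.rotations x) : M.PrecF x (x + M.chi x R) := by
  refine precF_iff.2 ⟨hx.1, add_chi_mem_GMatching hx hR, fun h => ?_, weakF_add_chi hx hR⟩
  obtain ⟨a, ha, haU⟩ := exists_mem_UPlus hx.1 hR
  have := congrFun h a
  rw [Pi.add_apply, chi_of_UPlus ha haU] at this
  omega

/-! ### Incomparability and number of rotations. -/

/-- Every stable matching above `x + χ^R` is strictly below `x` on the negative edges of `R`. -/
theorem lt_of_weakF_add_chi (hx : x ∈ M.Stable) {R : Cycle M.Edge} (hR : R ∈ M.rotations x)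
    (hy : y ∈ M.GMatching) (hRy : M.WeakF (x + M.chi x R) y) {c : M.Edge} (hc : c ∈ R)
    (hcU : c ∈ M.UMinus x) : y c < x c := by
  obtain ⟨a, ha, haU, hl⟩ := exists_legalF_to hx.1 (chain_exchange hR) hc hcU
  have hca := hl.2.1
  have hne := hl.2.2.1
  have hG := add_chi_mem_GMatching hx hR
  have hA := M.isChoice (Sum.inr a.1.2)
  have hC := hA.sup_trans (hx.1.2 _).1 (hG.2 _).1 (hy.2 _).1
    (weakF_add_chi hx hR a.1.2) (hRy a.1.2)
  -- The join of `y`, `x + χ^R` and `x` lies above `x + unit a`, from which the firm keeps only `x c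
  -- - 1` of `c`.
  have hl := ((legalF_iff (f := a.1.2) ⟨a, rfl⟩ ⟨c, hca⟩).1 hl).2.2
  have h1 := hA.min_le (sup_mem_box (hy.2 _).1 (sup_mem_box (hG.2 _).1 (hx.1.2 _).1))
    (hA.interesting_spec (hx.1.2 _) ((mem_UPlus_iff (f := a.1.2) ⟨a, rfl⟩).1 haU)).1
    (fun e => ?_) ⟨c, hca⟩
  · rw [hC, hl] at h1
    have hne' : (⟨c, hca⟩ : M.graph.Star (Sum.inr a.1.2)) ≠ ⟨a, rfl⟩ :=
      fun h => hne (congrArg Subtype.val h)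
    simp only [Pi.add_apply, Pi.sub_apply, unit_self, unit_of_ne hne', restr] at h1
    omega
  · by_cases he : e = ⟨a, rfl⟩
    · subst he
      simp only [Pi.add_apply, Pi.sup_apply, unit_self, restr, chi_of_UPlus ha haU]
      exact le_sup_of_le_right le_sup_left
    · simp only [Pi.add_apply, Pi.sup_apply, unit_of_ne he, add_zero]
      exact le_sup_of_le_right le_sup_right

/-- A negative edge of `R` must decrease under `R'` too, so the two cycles meet. -/
theorem eq_of_weakF_add_chi (hx : x ∈ M.Stable) {R R' : Cycle M.Edge} (hR : R ∈ M.rotations x)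
    (hR' : R' ∈ M.rotations x) (h : M.WeakF (x + M.chi x R) (x + M.chi x R')) : R = R' := by
  obtain ⟨a, ha, haU⟩ := exists_mem_UPlus hx.1 hR
  obtain ⟨c, hc, hcU, -⟩ := exists_legalF hx.1 hR ha haU
  have := lt_of_weakF_add_chi hx hR (add_chi_mem_GMatching hx hR') h hc hcU
  refine rotations_eq_of_mem hx hR hR' hc ?_
  by_contra hn
  rw [Pi.add_apply, chi_of_notMem hn] at this
  omega

/-- Among four consecutive edges, equality of two of the same sign would give an adjacent pair
sharing both ends, impossible without multiple edges. -/
theorem four_le_card_rotation [DecidableEq M.Edge] (hx : x ∈ M.Stable) {R : Cycle M.Edge}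
    (hR : R ∈ M.rotations x) {s : Finset M.Edge} (hs : ∀ e ∈ R, e ∈ s) : 4 ≤ s.card := by
  obtain ⟨a, ha, haU⟩ := exists_mem_UPlus hx.1 hR
  obtain ⟨c, hc, hcU, h1⟩ := exists_legalF hx.1 hR ha haU
  obtain ⟨a', ha', haU', h2⟩ := exists_essentialW hx.1 hR hc hcU
  obtain ⟨c', hc', hcU', h3⟩ := exists_legalF hx.1 hR ha' haU'
  have hne : ∀ {p q : M.Edge}, p ∈ M.UPlus x → q ∈ M.UMinus x → p ≠ q :=
    fun hp hq h => hq.2 (h ▸ hp)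
  have haa : a ≠ a' := by
    rintro rfl
    exact h1.2.2.1 (Subtype.ext (Prod.ext h2.1.2.2.1.symm h1.2.1))
  have hcc : c ≠ c' := by
    rintro rfl
    exact h3.2.2.1 (Subtype.ext (Prod.ext h2.1.2.2.1.symm h3.2.1))
  calc 4 = ({a, c, a', c'} : Finset M.Edge).card := by
        rw [Finset.card_insert_of_notMem, Finset.card_insert_of_notMem,
          Finset.card_insert_of_notMem, Finset.card_singleton]
        · simpa using hne haU' hcU'
        · simpa using ⟨(hne haU' hcU).symm, hcc⟩
        · simpa using ⟨hne haU hcU, haa, hne haU hcU'⟩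
    _ ≤ s.card := Finset.card_le_card fun e he => hs e (by
        simp only [Finset.mem_insert, Finset.mem_singleton] at he
        rcases he with rfl | rfl | rfl | rfl <;> assumption)

theorem finite_rotations (hx : x ∈ M.Stable) : (M.rotations x).Finite := by
  refine Set.Finite.of_finite_image (f := fun R => {e | e ∈ R}) (Set.toFinite _)
    fun R hR R' hR' h => ?_
  obtain ⟨a, ha, -⟩ := exists_mem_UPlus hx.1 hR
  exact rotations_eq_of_mem hx hR hR' ha ((Set.ext_iff.1 h a).1 ha)

theorem four_mul_ncard_rotations_le (hx : x ∈ M.Stable) :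
    4 * (M.rotations x).ncard ≤ M.graph.edges.card := by
  classical
  have hfin := finite_rotations hx
  rw [Set.ncard_eq_toFinset_card _ hfin, ← Fintype.card_coe M.graph.edges, mul_comm]
  let t : Cycle M.Edge → Finset M.Edge := fun R => {e | e ∈ R}
  calc hfin.toFinset.card * 4 ≤ ∑ R ∈ hfin.toFinset, (t R).card :=
        Finset.card_nsmul_le_sum _ _ _ fun R hR =>
          four_le_card_rotation hx (hfin.mem_toFinset.1 hR) (by simp [t])
    _ = (hfin.toFinset.biUnion t).card := by
        refine (Finset.card_biUnion fun R hR R' hR' hne => ?_).symm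
        refine Finset.disjoint_left.2 fun e he he' => hne ?_
        exact rotations_eq_of_mem hx (hfin.mem_toFinset.1 hR) (hfin.mem_toFinset.1 hR')
          (by simpa [t] using he) (by simpa [t] using he')
    _ ≤ _ := Finset.card_le_univ _

/-! ### From a larger stable matching back to a rotation. -/

theorem mem_UPlus_of_lt (hx : x ∈ M.GMatching) (hy : y ∈ M.GMatching) (hxy : M.WeakF x y)
    {e : M.Edge} (he : x e < y e) : e ∈ M.UPlus x := by
  refine (mem_UPlus_iff (f := e.1.2) ⟨e, rfl⟩).2 ?_
  refine (M.isChoice _).interesting_of_le (hx.2 _).1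
    (sup_mem_box (hy.2 (Sum.inr e.1.2)).1 (hx.2 _).1) le_sup_right ?_
  rw [hxy e.1.2]
  exact he

/-- Polarity: what is better for the firms is worse for the workers. -/
theorem choice_worker_sup (hx : x ∈ M.Stable) (hy : y ∈ M.GMatching) (hxy : M.WeakF x y)
    (w : W) : M.C (Sum.inl w) (M.graph.restr x (Sum.inl w) ⊔ M.graph.restr y (Sum.inl w)) =
      M.graph.restr x (Sum.inl w) := by
  refine (M.isChoice _).choice_eq_of_not_interesting (hx.1.2 _)
    (sup_mem_box (hx.1.2 _).1 (hy.2 _).1) le_sup_left fun e he hi => ?_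
  have hlt : x e.1 < y e.1 := by simpa [restr] using he
  have hU := mem_UPlus_of_lt hx.1 hy hxy hlt
  obtain ⟨e, rfl⟩ := e
  exact hx.2 e ⟨⟨rfl, hi⟩, hU⟩

theorem sum_restr_firms [Fintype F] (x : M.Edge → ℤ) :
    ∑ f : F, ∑ e, M.graph.restr x (Sum.inr f) e = ∑ e, x e := by
  classical
  rw [← Finset.sum_fiberwise Finset.univ (fun e : M.Edge => e.1.2)]
  exact Finset.sum_congr rfl fun v _ => (Finset.sum_subtype _ (by simp [Inc]) _).symm

theorem sum_restr_workers [Fintype W] (x : M.Edge → ℤ) :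
    ∑ w : W, ∑ e, M.graph.restr x (Sum.inl w) e = ∑ e, x e := by
  classical
  rw [← Finset.sum_fiberwise Finset.univ (fun e : M.Edge => e.1.1)]
  exact Finset.sum_congr rfl fun v _ => (Finset.sum_subtype _ (by simp [Inc]) _).symm

/-- Comparable stable matchings have the same size at every vertex. -/
theorem sum_restr_eq [Finite W] [Finite F] (hx : x ∈ M.Stable) (hy : y ∈ M.GMatching)
    (hxy : M.WeakF x y) (v : W ⊕ F) :
    ∑ e, M.graph.restr x v e = ∑ e, M.graph.restr y v e := by
  have := Fintype.ofFinite W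
  have := Fintype.ofFinite F
  have hf : ∀ f : F, ∑ e, M.graph.restr x (Sum.inr f) e ≤ ∑ e, M.graph.restr y (Sum.inr f) e :=
    fun f => by
      have := (M.isChoice (Sum.inr f)).size_monotone _
        (sup_mem_box (hy.2 _).1 (hx.1.2 _).1) _ (hx.1.2 _).1 le_sup_right
      rwa [hxy f, (hx.1.2 _).2] at this
  have hw : ∀ w : W, ∑ e, M.graph.restr y (Sum.inl w) e ≤ ∑ e, M.graph.restr x (Sum.inl w) e :=
    fun w => by
      have := (M.isChoice (Sum.inl w)).size_monotone _
        (sup_mem_box (hx.1.2 _).1 (hy.2 _).1) _ (hy.2 _).1 le_sup_right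
      rwa [choice_worker_sup hx hy hxy w, (hy.2 _).2] at this
  -- Firms' sizes weakly grow and workers' weakly shrink, yet both add up to the same total over the
  -- edges; so equality holds at each vertex.
  have hf' := Finset.sum_le_sum fun f (_ : f ∈ Finset.univ) => hf f
  have hw' := Finset.sum_le_sum fun w (_ : w ∈ Finset.univ) => hw w
  have h1 := hf'
  have h2 := hw'
  rw [sum_restr_firms, sum_restr_firms] at h1
  rw [sum_restr_workers, sum_restr_workers] at h2
  rcases v with w | f
  · refine ((Finset.sum_eq_sum_iff_of_le fun w _ => hw w).1 ?_ w (Finset.mem_univ w)).symm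
    rw [sum_restr_workers, sum_restr_workers]
    exact le_antisymm h2 h1
  · refine (Finset.sum_eq_sum_iff_of_le fun f _ => hf f).1 ?_ f (Finset.mem_univ f)
    rw [sum_restr_firms, sum_restr_firms]
    exact le_antisymm h1 h2

/-- An edge interesting for its firm under `x` whose additional unit is of no use to the firm
under `y`. -/
def Attained (M : Market W F) (x y : M.Edge → ℤ) (a : M.Edge) : Prop :=
  a ∈ M.UPlus x ∧ M.C (Sum.inr a.1.2) (M.graph.restr y (Sum.inr a.1.2) ⊔
    M.graph.restr (x + unit a) (Sum.inr a.1.2)) = M.graph.restr y (Sum.inr a.1.2)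

theorem attained_of_lt (hx : x ∈ M.GMatching) (hy : y ∈ M.GMatching) (hxy : M.WeakF x y)
    {e : M.Edge} (he : x e < y e) : M.Attained x y e := by
  refine ⟨mem_UPlus_of_lt hx hy hxy he, ?_⟩
  rw [← hxy e.1.2]
  congr 1
  rw [hxy]
  funext e'
  simp only [restr, Pi.sup_apply, Pi.add_apply]
  by_cases h : e'.1 = e
  · rw [h, unit_self]; omega
  · rw [unit_of_ne h, add_zero]

/-- The size at the firm cannot exceed that of `y`, which is that of `x`, so taking `a` costs a unit
of some `c`; by substitutability `y` lacks that unit as well. -/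
theorem exists_legalF_of_attained [Finite W] [Finite F] (hx : x ∈ M.Stable)
    (hy : y ∈ M.GMatching) (hxy : M.WeakF x y) {a : M.Edge} (ha : M.Attained x y a) :
    ∃ c, (c ∈ M.UMinus x ∧ y c < x c) ∧ M.LegalF x a c := by
  obtain ⟨haU, hC⟩ := ha
  have hA := M.isChoice (Sum.inr a.1.2)
  have hi := (mem_UPlus_iff (f := a.1.2) ⟨a, rfl⟩).1 haU
  have hb := (hA.interesting_spec (hx.1.2 _) hi).1
  rw [restr_add_unit (v := Sum.inr a.1.2) ⟨a, rfl⟩] at hC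
  have hsz := hA.size_monotone _ (sup_mem_box (hy.2 _).1 hb) _ hb le_sup_right
  rw [hC, ← sum_restr_eq hx hy hxy] at hsz
  rcases hA.choice_add_unit (hx.1.2 _) hi with h | ⟨c, hne, h⟩
  · rw [h] at hsz
    simp only [Pi.add_apply, Finset.sum_add_distrib, sum_unit] at hsz
    omega
  · have hl : M.LegalF x a c.1 :=
      (legalF_iff (f := a.1.2) ⟨a, rfl⟩ c).2 ⟨haU, hne, h⟩
    refine ⟨c.1, ⟨hl.mem_UMinus hx.1, ?_⟩, hl⟩
    have := hA.min_le (sup_mem_box (hy.2 _).1 hb) hb le_sup_right c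
    rw [hC, h] at this
    simp only [Pi.add_apply, Pi.sub_apply, unit_self, unit_of_ne hne, restr] at this
    omega

/-- At the worker `y` fits below the raised vector less a unit of `c`. The choice from the latter
thus has the size of `x`; it also contains `x - unit c`, so exactly one unit `a` is added. -/
theorem exists_essentialW_of_lt [Finite W] [Finite F] (hx : x ∈ M.Stable)
    (hy : y ∈ M.Stable) (hxy : M.WeakF x y) {c : M.Edge} (hc : c ∈ M.UMinus x)
    (hlt : y c < x c) : ∃ a, M.Attained x y a ∧ M.EssentialW x c a := by
  have hA := M.isChoice (Sum.inl c.1.1)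
  have hD := box_restr (raise_mem_box hx.1.1) (Sum.inl c.1.1)
  have hCD := choice_raise hx c.1.1
  set c' : M.graph.Star (Sum.inl c.1.1) := ⟨c, rfl⟩
  have hDc : M.raise x c = x c := raise_of_notMem hc.2
  have hb : M.graph.restr (M.raise x) (Sum.inl c.1.1) - unit c' ∈ _ :=
    sub_unit_mem_box hD (hc.1.trans_eq hDc.symm)
  have hle : M.graph.restr (M.raise x) (Sum.inl c.1.1) - unit c' ≤
      M.graph.restr (M.raise x) (Sum.inl c.1.1) := fun e => by simp [unit_nonneg]
  have hyD : M.graph.restr y (Sum.inl c.1.1) ≤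
      M.graph.restr (M.raise x) (Sum.inl c.1.1) - unit c' := fun e => by
    by_cases he : e = c'
    · subst he
      have hcc : c'.1 = c := rfl
      simp only [Pi.sub_apply, unit_self, restr, hcc]
      omega
    · simp only [Pi.sub_apply, unit_of_ne he, restr, sub_zero]
      by_cases hlt : x e.1 < y e.1
      · rw [raise_of_mem (mem_UPlus_of_lt hx.1 hy.1 hxy hlt)]
        exact (hy.1.1 e.1).2
      · exact (not_lt.1 hlt).trans (le_raise hx.1.1 _)
  have hs1 := hA.size_monotone _ hD _ hb hle
  have hs2 := hA.size_monotone _ hb _ (hy.1.2 _).1 hyD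
  rw [hCD] at hs1
  rw [(hy.1.2 _).2, ← sum_restr_eq hx hy.1 hxy] at hs2
  have hge : M.graph.restr x (Sum.inl c.1.1) - unit c' ≤
      M.C (Sum.inl c.1.1) (M.graph.restr (M.raise x) (Sum.inl c.1.1) - unit c') := fun e => by
    have h1 := hA.min_le hD hb hle e
    have h2 : M.graph.restr x (Sum.inl c.1.1) e ≤ M.graph.restr (M.raise x) (Sum.inl c.1.1) e :=
      le_raise hx.1.1 e.1
    have h3 := unit_nonneg c' e
    rw [hCD] at h1
    simp only [Pi.sub_apply] at h1 ⊢
    omega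
  obtain ⟨a, ha⟩ := eq_add_unit_of_le hge (by
    simp only [Pi.sub_apply, Finset.sum_sub_distrib, sum_unit]
    omega)
  rw [sub_add_eq_add_sub] at ha
  have hess : M.EssentialW x c a.1 := (essentialW_iff hx c' a).2 ⟨hc, ha⟩
  have haU := hess.1.2.1
  refine ⟨a.1, ?_, hess⟩
  have hac : a ≠ c' := fun h => hc.2 (by rw [h] at haU; exact haU)
  by_cases hlt' : x a.1 < y a.1
  · exact attained_of_lt hx.1 hy.1 hxy hlt'
  refine ⟨haU, ?_⟩
  have hlt' := not_lt.1 hlt'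
  -- Here `y a ≤ x a`, while the worker takes `x a + 1` from an offer above `y`. So the worker wants
  -- `a` under `y`, and stability of `y` makes the firm refuse it.
  have hiw : M.InterestingFor y (Sum.inl a.1.1.1) a.1 := by
    have hiw : Interesting (M.graph.restr M.cap (Sum.inl c.1.1)) (M.C (Sum.inl c.1.1))
        (M.graph.restr y (Sum.inl c.1.1)) a := by
      refine hA.interesting_of_le (hy.1.2 _).1 hb hyD ?_
      rw [ha]
      simp only [Pi.add_apply, Pi.sub_apply, unit_self, unit_of_ne hac, restr]
      omega
    have := (interestingFor_iff a).2 hiw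
    have haw : a.1.1.1 = c.1.1 := a.2
    rwa [haw]
  have hnf : ¬ Interesting (M.graph.restr M.cap (Sum.inr a.1.1.2)) (M.C (Sum.inr a.1.1.2))
      (M.graph.restr y (Sum.inr a.1.1.2)) ⟨a.1, rfl⟩ := fun h =>
    hy.2 a.1 ⟨hiw, (interestingFor_iff (v := Sum.inr a.1.1.2) ⟨a.1, rfl⟩).2 h⟩
  have hAf := M.isChoice (Sum.inr a.1.1.2)
  have hxa : M.graph.restr (x + unit a.1) (Sum.inr a.1.1.2) ∈
      box (M.graph.restr M.cap (Sum.inr a.1.1.2)) :=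
    box_restr (add_unit_mem_box hx.1.1 (lt_cap_of_mem_UPlus haU)) _
  refine hAf.eq_of_le (sup_mem_box (hy.1.2 _).1 hxa) (hy.1.2 _) le_sup_left fun e => ?_
  have hbig := sup_mem_box (hy.1.2 (Sum.inr a.1.1.2)).1 hxa
  by_cases he : e = ⟨a.1, rfl⟩
  · subst he
    by_contra! hlt2
    exact hnf (hAf.interesting_of_le (hy.1.2 _).1 hbig le_sup_left hlt2)
  · have hle2 : M.graph.restr y (Sum.inr a.1.1.2) ⊔ M.graph.restr x (Sum.inr a.1.1.2) ≤
        M.graph.restr y (Sum.inr a.1.1.2) ⊔ M.graph.restr (x + unit a.1) (Sum.inr a.1.1.2) :=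
      sup_le_sup_left (fun e' => by simp [restr, unit_nonneg]) _
    have h1 := hAf.min_le hbig (sup_mem_box (hy.1.2 _).1 (hx.1.2 _).1) hle2 e
    have h2 := hAf.le_self _ hbig e
    have he' : e.1 ≠ a.1 := fun h => he (Subtype.ext h)
    rw [hxy] at h1
    simp only [Pi.sup_apply, restr, Pi.add_apply, unit_of_ne he', add_zero] at h1 h2 ⊢
    omega

/-- A cycle of exchanges survives the cleaning procedure. -/
theorem mem_rotations_of_exchange (hx : x ∈ M.GMatching) {R : Cycle M.Edge}
    (hne : R ≠ Cycle.nil) (hnd : R.Nodup) (hR : R.Chain (M.Exchange x)) :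
    R ∈ M.rotations x := by
  have hcl : ∀ (n : ℕ), ∀ e ∈ R, AuxVertex.w e ∈ (M.cleanStep x)^[n] (M.auxVertices x) ∧
      AuxVertex.f e ∈ (M.cleanStep x)^[n] (M.auxVertices x) := by
    intro n
    induction n with
    | zero =>
      intro e he
      have := mem_UPlus_or_mem_UMinus hx hR he
      exact ⟨⟨e, this, Or.inl rfl⟩, ⟨e, this, Or.inr rfl⟩⟩
    | succ n ih =>
      intro e he
      rw [Function.iterate_succ_apply']
      -- Each of the two copies of `e` is entered either from the other copy or from the same-side
      -- copy of the predecessor of `e`.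
      rcases mem_UPlus_or_mem_UMinus hx hR he with hU | hU
      · obtain ⟨c, hc, -, h⟩ := exists_essentialW_to hx hR he hU
        exact ⟨⟨(ih e he).1, _, (ih c hc).1, AuxArc.essential c e h⟩,
          ⟨(ih e he).2, _, (ih e he).1, AuxArc.pos e hU⟩⟩
      · obtain ⟨a, ha, -, h⟩ := exists_legalF_to hx hR he hU
        exact ⟨⟨(ih e he).1, _, (ih e he).2, AuxArc.neg e hU⟩,
          ⟨(ih e he).2, _, (ih a ha).2, AuxArc.legal a e h⟩⟩
  have hcl' : ∀ e ∈ R, AuxVertex.w e ∈ M.cleaned x ∧ AuxVertex.f e ∈ M.cleaned x := fun e he =>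
    ⟨Set.mem_iInter.2 fun n => (hcl n e he).1, Set.mem_iInter.2 fun n => (hcl n e he).2⟩
  refine ⟨hne, hnd, ?_⟩
  refine Cycle.Chain.imp_of_mem (fun e he e' he' h => ?_) hR
  exact h.imp (fun h => ⟨h, (hcl' e he).2, (hcl' e' he').2⟩)
    fun h => ⟨h, (hcl' e he).1, (hcl' e' he').1⟩

/-- Below every larger stable matching there is a rotation. -/
theorem exists_rotation_weakF [Finite W] [Finite F] (hx : x ∈ M.Stable) (hy : y ∈ M.Stable)
    (hne : x ≠ y) (hxy : M.WeakF x y) :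
    ∃ R ∈ M.rotations x, M.WeakF (x + M.chi x R) y := by
  -- Vectors of equal size at each firm cannot satisfy `y ≤ x` unless they coincide.
  have hstart : ∃ e, x e < y e := by
    by_contra! hcon
    refine hne (ext_firms fun f => (eq_of_le_of_sum_le (fun (e : M.graph.Star _) => hcon e.1) ?_).symm)
    exact (sum_restr_eq hx hy.1 hxy _).le
  obtain ⟨e₀, he₀⟩ := hstart
  obtain ⟨R, hnil, hnd, hR, hQ⟩ := Cycle.exists_of_forall_succ (r := M.Exchange x)
    (Q := fun e => M.Attained x y e ∨ (e ∈ M.UMinus x ∧ y e < x e))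
    ⟨e₀, Or.inl (attained_of_lt hx.1 hy.1 hxy he₀)⟩ (by
      rintro e (he | he)
      · obtain ⟨c, hc, h⟩ := exists_legalF_of_attained hx hy.1 hxy he
        exact ⟨c, Or.inr hc, Or.inl h⟩
      · obtain ⟨a, ha, h⟩ := exists_essentialW_of_lt hx hy hxy he.1 he.2
        exact ⟨a, Or.inl ha, Or.inr h⟩)
  have hRr := mem_rotations_of_exchange hx.1 hnil hnd hR
  refine ⟨R, hRr, fun f => ?_⟩
  have hA := M.isChoice (Sum.inr f)
  have hb := (choice_firm_rotation hx hRr f).1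
  have hC := hA.choice_sup_add_indic (A := M.posAt x R (Sum.inr f)) (hx.1.2 _).1 (hy.1.2 _)
    (hxy f) (fun a ha => lt_cap_of_mem_UPlus (mem_posAt.1 ha).2) (fun a ha => by
      have ha := mem_posAt.1 ha
      have hat : M.Attained x y a.1 := (hQ a.1 ha.1).resolve_right fun h => h.1.2 ha.2
      rw [← restr_add_unit]
      obtain ⟨a, rfl⟩ := a
      exact hat.2)
  -- The firm keeps `y` even when offered all positive edges of `R`, and `x + χ^R` is smaller than
  -- that offer.
  refine hA.eq_of_between (sup_mem_box (hy.1.2 _).1 hb) hC le_sup_left (sup_le_sup_left ?_ _)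
  rw [restr_add_chi hx.1 hRr]
  intro e
  have : 0 ≤ indic (M.negAt x R (Sum.inr f)) e := by unfold indic; split_ifs <;> simp
  simpa using this

end Market

end SGMM

open SGMM Market in
theorem corollary3p9 {W F : Type*} [Finite W] [Finite F] (M : SGMM.Market W F)
    (x : M.Edge → ℤ) (hx : x ∈ M.Stable) :
    (∀ R ∈ M.rotations x, x + M.chi x R ∈ M.Stable ∧ M.PrecF x (x + M.chi x R)) ∧
    (∀ y ∈ M.Stable, M.PrecF x y →
      ∃ R ∈ M.rotations x, x + M.chi x R = y ∨ M.PrecF (x + M.chi x R) y) ∧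
    M.immediateSuccessors x = (fun R => x + M.chi x R) '' M.rotations x ∧
    (M.rotations x).Finite ∧
    (M.immediateSuccessors x).ncard = (M.rotations x).ncard ∧
    ((M.rotations x).ncard : ℝ) ≤ (M.graph.edges.card : ℝ) / 4 := by
  have h1 : ∀ R ∈ M.rotations x, x + M.chi x R ∈ M.Stable ∧ M.PrecF x (x + M.chi x R) :=
    fun R hR => ⟨add_chi_mem_Stable hx hR, precF_add_chi hx hR⟩
  have h2 : ∀ y ∈ M.Stable, M.PrecF x y →
      ∃ R ∈ M.rotations x, x + M.chi x R = y ∨ M.PrecF (x + M.chi x R) y := by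
    intro y hy hxy
    have hxy := precF_iff.1 hxy
    obtain ⟨R, hR, hRy⟩ := exists_rotation_weakF hx hy hxy.2.2.1 hxy.2.2.2
    refine ⟨R, hR, or_iff_not_imp_left.2 fun hne => ?_⟩
    exact precF_iff.2 ⟨add_chi_mem_GMatching hx hR, hy.1, hne, hRy⟩
  have h3 : M.immediateSuccessors x = (fun R => x + M.chi x R) '' M.rotations x := by
    ext y
    constructor
    · rintro ⟨hy, hxy, hno⟩
      obtain ⟨R, hR, h | h⟩ := h2 y hy hxy
      · exact ⟨R, hR, h⟩
      · exact absurd ⟨_, (h1 R hR).1, (h1 R hR).2, h⟩ hno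
    · rintro ⟨R, hR, rfl⟩
      refine ⟨(h1 R hR).1, (h1 R hR).2, ?_⟩
      rintro ⟨z, hz, hxz, hzR⟩
      have hxz := precF_iff.1 hxz
      have hzR := precF_iff.1 hzR
      -- A rotation `R'` below `z` gives `x + χ^R' ⪯ z ⪯ x + χ^R`; incomparability forces `R' = R`,
      -- and antisymmetry contradicts strictness.
      obtain ⟨R', hR', hle⟩ := exists_rotation_weakF hx hz hxz.2.2.1 hxz.2.2.2
      obtain rfl := eq_of_weakF_add_chi hx hR' hR
        (hle.trans (add_chi_mem_GMatching hx hR') hz.1 hzR.2.1 hzR.2.2.2)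
      exact hzR.2.2.1 (hzR.2.2.2.antisymm hle)
  refine ⟨h1, h2, h3, finite_rotations hx, ?_, ?_⟩
  · rw [h3]
    refine Set.InjOn.ncard_image fun R hR R' hR' h => ?_
    refine eq_of_weakF_add_chi hx hR hR' ?_
    have h : x + M.chi x R = x + M.chi x R' := h
    rw [h]
    exact WeakF.refl (add_chi_mem_GMatching hx hR')
  · have := four_mul_ncard_rotations_le hx
    rw [le_div_iff₀ (by norm_num), mul_comm]
    exact_mod_cast this
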